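/- Let $\ell^2=\ell^2(\mathbb N;\mathbb C)$ and let $P_k x=(x_0,\dots,x_k,0,0,\dots)$. A bounded operator $A$ on $\ell^2$ is causal if $P_kAP_k=P_kA$ for all $k\ge 0$; write $\mathcal B_c$ for the algebra of causal operators and $\mathcal K$ for the compact operators on $\ell^2$. Equip $\ell^2\times\ell^2$ with its Hilbert space norm. A bounded operator $A$ between Hilbert spaces is a partial isometry if $\|Au\|=\|u\|$ for all $u\in(\ker A)^\perp$. An operator $U\in\mathcal B_c$ is inner if it is a partial isometry and $U^\star U$ commutes with all $P_k$. Let $W,V,P\in\mathcal B_c$. Let $\Lambda_1$ be invertible in $\mathcal B_c$ with $\Lambda_1^\star\Lambda_1=W^\star W+V^\star V$, let $\Lambda_1P=U_1G$ with $U_1$ inner and $G$ invertible in $\mathcal B_c$, put $R=\begin{pmatrix}W\\V\end{pmatrix}\Lambda_1^{-1}U_1$, let $\Lambda$ be invertible in $\mathcal B_c$ with $R^\star R=\Lambda^\star\Lambda$, and put $$T_1=\begin{pmatrix}W\\0\end{pmatrix},\qquad R_2=R\Lambda^{-1},\qquad \mu_o=\inf_{Q\in\mathcal B_c}\|T_1-R_2Q\|,\qquad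 \mu_{oo}'=\inf_{Q\in\mathcal K}\|T_1-R_2Q\| .$$ Call $Q_o\in\mathcal B_c$ optimal if $\|T_1-R_2Q_o\|=\mu_o$. (1) If $T_1$ is compact and $\mu_o>\mu_{oo}'$, then there is an optimal $Q_o\in\mathcal B_c$ such that $\dfrac{T_1-R_2Q_o}{\mu_o}$ is a partial isometry from $\ell^2$ to $\ell^2\times\ell^2$. (2) The condition $\mu_o>\mu_{oo}'$ is sharp in the following sense. (a) There are $T_1$ and $R_2$ as above (with $T_1$ not required to be compact) for which $\mu_o>\mu'_{oo}$ fails, indeed $0<\mu_o\le\|T_1-R_2Q\|$ for every bounded $Q$, for which an optimal $Q_o$ exists, and for which $(T_1-R_2Q_o)/\mu_o$ is not a partial isometry for any optimal $Q_o$. (b) There are $T_1$ and $R_2$ as above, with $T_1$ compact and $\mu_o>0$, for which $\mu_o>\mu'_{oo}$ fails, and an optimal $Q_o$ for which $(T_1-R_2Q_o)/\mu_o$ is not a partial isometry. -/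

import Mathlib

open ContinuousLinearMap (adjoint)

noncomputable section

namespace MixedSensitivity

/-- The complex Hilbert space `ℓ²` of square summable sequences `(x₀, x₁, x₂, …)`. -/
abbrev Ell2 : Type := lp (fun _ : ℕ => ℂ) 2

/-- The product `ℓ² × ℓ²` with its Hilbert space norm `(‖x₁‖² + ‖x₂‖²)^(1/2)`. -/
abbrev Ell2Sq : Type := WithLp 2 (Ell2 × Ell2)

/-- The truncation `P_k x = (x₀, …, x_k, 0, 0, …)`. -/
def truncation (k : ℕ) : Ell2 →L[ℂ] Ell2 :=
  ∑ i ∈ Finset.range (k + 1),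
    lp.singleContinuousLinearMap ℂ (fun _ : ℕ => ℂ) 2 i ∘L lp.evalCLM ℂ (fun _ : ℕ => ℂ) 2 i

theorem truncation_apply (k : ℕ) (x : Ell2) (j : ℕ) :
    truncation k x j = if j ≤ k then x j else 0 := by
  have h : ∀ i, lp.evalCLM ℂ (fun _ : ℕ => ℂ) 2 i x = x i := fun _ => rfl
  simp only [truncation, _root_.sum_apply, lp.coeFn_sum, Finset.sum_apply]
  simp [Pi.single_apply, h]

/-- `A` is causal: `P_k A P_k = P_k A` for every `k`, that is, its matrix is lower triangular. -/
def IsCausal (A : Ell2 →L[ℂ] Ell2) : Prop :=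
  ∀ k : ℕ, truncation k ∘L A ∘L truncation k = truncation k ∘L A

/-- `A` is invertible in the algebra of causal operators: `A` and `A⁻¹` are causal. -/
def IsCausalUnit (A : (Ell2 →L[ℂ] Ell2)ˣ) : Prop :=
  IsCausal (A : Ell2 →L[ℂ] Ell2) ∧ IsCausal ((A⁻¹ : (Ell2 →L[ℂ] Ell2)ˣ) : Ell2 →L[ℂ] Ell2)

/-- The column operator `x ↦ (B₁ x, B₂ x)` from `ℓ²` to `ℓ² × ℓ²`. -/
def column (B₁ B₂ : Ell2 →L[ℂ] Ell2) : Ell2 →L[ℂ] Ell2Sq :=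
  (WithLp.prodContinuousLinearEquiv 2 ℂ Ell2 Ell2).symm.toContinuousLinearMap ∘L B₁.prod B₂

/-- A bounded operator is a partial isometry if it preserves the norm of every vector of the
orthogonal complement of its null space. -/
def IsPartialIsometry {H K : Type*} [NormedAddCommGroup H] [InnerProductSpace ℂ H]
    [NormedAddCommGroup K] [InnerProductSpace ℂ K] (A : H →L[ℂ] K) : Prop :=
  ∀ u ∈ (LinearMap.ker (A : H →ₗ[ℂ] K))ᗮ, ‖A u‖ = ‖u‖

/-- A causal operator `U` is inner if it is a partial isometry and `U⋆ U` commutes with the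
projections `I - P_n`, equivalently with the `P_n`. -/
def IsInner (U : Ell2 →L[ℂ] Ell2) : Prop :=
  IsCausal U ∧ IsPartialIsometry U ∧
    ∀ n : ℕ, (adjoint U ∘L U) ∘L truncation n = truncation n ∘L (adjoint U ∘L U)

/-- `R₂` is the normalized operator of the mixed sensitivity problem with weights `W`, `V` and
plant `P`: there are
* an outer spectral factor `Λ₁`, with `Λ₁` and `Λ₁⁻¹` causal and `Λ₁⋆ Λ₁ = W⋆ W + V⋆ V`,
* an inner-outer factorization `Λ₁ P = U₁ G` whose outer factor `G` is invertible in the causal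
  operators (such a `G` is automatically outer),
* a spectral factor `Λ`, with `Λ` and `Λ⁻¹` causal and `R⋆ R = Λ⋆ Λ`, where
  `R = (W, V) Λ₁⁻¹ U₁`,

such that `R₂ = R Λ⁻¹`. -/
def IsNormalizedFactor (W V P : Ell2 →L[ℂ] Ell2) (R₂ : Ell2 →L[ℂ] Ell2Sq) : Prop :=
  IsCausal W ∧ IsCausal V ∧ IsCausal P ∧
  ∃ (Λ₁ G Λ : (Ell2 →L[ℂ] Ell2)ˣ) (U₁ : Ell2 →L[ℂ] Ell2) (R : Ell2 →L[ℂ] Ell2Sq),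
    IsCausalUnit Λ₁ ∧
    adjoint (Λ₁ : Ell2 →L[ℂ] Ell2) ∘L (Λ₁ : Ell2 →L[ℂ] Ell2)
      = adjoint W ∘L W + adjoint V ∘L V ∧
    IsInner U₁ ∧ IsCausalUnit G ∧
    (Λ₁ : Ell2 →L[ℂ] Ell2) ∘L P = U₁ ∘L (G : Ell2 →L[ℂ] Ell2) ∧
    R = column W V ∘L ((Λ₁⁻¹ : (Ell2 →L[ℂ] Ell2)ˣ) : Ell2 →L[ℂ] Ell2) ∘L U₁ ∧
    IsCausalUnit Λ ∧
    adjoint R ∘L R = adjoint (Λ : Ell2 →L[ℂ] Ell2) ∘L (Λ : Ell2 →L[ℂ] Ell2) ∧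
    R₂ = R ∘L ((Λ⁻¹ : (Ell2 →L[ℂ] Ell2)ˣ) : Ell2 →L[ℂ] Ell2)

/-- `μ_o`: the infimum of `‖T₁ - R₂ Q‖` over all causal `Q`. -/
def muCausal (T₁ R₂ : Ell2 →L[ℂ] Ell2Sq) : ℝ :=
  ⨅ Q : {Q : Ell2 →L[ℂ] Ell2 // IsCausal Q}, ‖T₁ - R₂ ∘L (Q : Ell2 →L[ℂ] Ell2)‖

/-- `μ'_oo`: the infimum of `‖T₁ - R₂ Q‖` over all compact `Q`, causal or not. -/
def muCompact (T₁ R₂ : Ell2 →L[ℂ] Ell2Sq) : ℝ :=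
  ⨅ Q : {Q : Ell2 →L[ℂ] Ell2 // IsCompactOperator Q}, ‖T₁ - R₂ ∘L (Q : Ell2 →L[ℂ] Ell2)‖

/-- `Q` is optimal: it is causal and attains `μ_o`. -/
def IsOptimal (T₁ R₂ : Ell2 →L[ℂ] Ell2Sq) (Q : Ell2 →L[ℂ] Ell2) : Prop :=
  IsCausal Q ∧ ‖T₁ - R₂ ∘L Q‖ = muCausal T₁ R₂

/-- The normalized operator `(T₁ - R₂ Q) / μ_o`. -/
def normalizedError (T₁ R₂ : Ell2 →L[ℂ] Ell2Sq) (Q : Ell2 →L[ℂ] Ell2) : Ell2 →L[ℂ] Ell2Sq :=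
  ((muCausal T₁ R₂ : ℝ) : ℂ)⁻¹ • (T₁ - R₂ ∘L Q)

end MixedSensitivity

end

/-! Since `R₂` is an isometry, the error splits orthogonally: with A = R₂⋆T₁ and B = T₁ - R₂R₂⋆T₁
one has ‖(T₁ - R₂Q)x‖² = ‖(A - Q)x‖² + ‖Bx‖². Hence ‖B‖ ≤ μ'_oo < μ_o, and D = (μ_o² - B⋆B)^(1/2) is
invertible. It suffices to find a causal Q with ‖(A - Q)x‖ = ‖Dx‖ for all x: then T₁ - R₂Q is μ_o
times an isometry, so Q is optimal and the normalized error is isometric.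

Such a Q is sought with A - Q = J⋆D, J unitary. On adjoints, causality of Q means that Jx - D⁻¹A⋆x
lies in N_k = D⁻¹ span(e₀, …, e_k) whenever x lies in that span. So the vectors r_k = Je_k must form
an orthonormal sequence with r_k - D⁻¹A⋆e_k in N_k. They are chosen one after another
(`exists_unit_mem_orthogonal`, `exists_orthonormal_sub_mem`). The part of D⁻¹A⋆ outside N_k is
contractive on the span, by a limit over nearly optimal causal Q, and this makes the orthogonality
conditions solvable; dim N_k = k + 1 exceeds the number k of earlier vectors, which leaves a
direction for adjusting the norm. The resulting J is isometric. Compactness of A makes it onto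
(`surjective_of_sub_mem`): for large k it nearly maps the span into N_k, a space of the same
dimension.

For sharpness, diagonal weights are chosen so that e₀ alone forces the optimal value for every
bounded Q, which leaves a smaller gain possible on e₁. In the first example e₁ is outside the range
of the inner factor, and saturated later coordinates force Qe₁ = 0, so every optimum has too small a
gain there; in the second a non-allpass optimum is written down. -/

noncomputable section

namespace MixedSensitivity

open Filter Topology

/-! ### Orthonormal completion along an increasing sequence of subspaces -/

section Hilbert

variable {E : Type*} [NormedAddCommGroup E] [InnerProductSpace ℂ E]

/-- A functional which is dominated by a linear map `L` into a finite dimensional space is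
represented by a vector of the range of `L`. -/
theorem exists_mem_range_inner_eq {R F : Type*} [AddCommGroup R] [Module ℂ R]
    [NormedAddCommGroup F] [InnerProductSpace ℂ F] [FiniteDimensional ℂ F]
    (L : R →ₗ[ℂ] F) (f : R →ₗ[ℂ] ℂ) (C : ℝ) (hC : 0 ≤ C) (h : ∀ u, ‖f u‖ ≤ C * ‖L u‖) :
    ∃ u₀ : R, ‖L u₀‖ ≤ C ∧ ∀ u, inner ℂ (L u₀) (L u) = f u := by
  obtain ⟨g, hg⟩ := L.rangeRestrict.exists_rightInverse_of_surjective L.range_rangeRestrict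
  have hLg : ∀ y : LinearMap.range L, L (g y) = y := fun y => by
    have := congrArg Subtype.val (LinearMap.congr_fun hg y)
    simpa using this
  let φ : LinearMap.range L →L[ℂ] ℂ := (f ∘ₗ g).mkContinuous C fun y => by
    have := h (g y)
    rw [hLg] at this
    simpa using this
  have hφ : ‖φ‖ ≤ C := LinearMap.mkContinuous_norm_le _ hC _
  obtain ⟨u₀, hu₀⟩ := ((InnerProductSpace.toDual ℂ (LinearMap.range L)).symm φ).2
  refine ⟨u₀, ?_, fun u => ?_⟩
  · rw [hu₀, ← Submodule.coe_norm, LinearIsometryEquiv.norm_map]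
    exact hφ
  · have hmem : L u ∈ LinearMap.range L := ⟨u, rfl⟩
    have h1 : inner ℂ (L u₀) (L u) = φ ⟨L u, hmem⟩ := by
      rw [hu₀, ← InnerProductSpace.toDual_symm_apply, Submodule.coe_inner]
    rw [h1]
    change f (g ⟨L u, hmem⟩) = f u
    -- The bound makes f vanish on ker L, so f does not see which preimage g selects.
    have h2 := h (g ⟨L u, hmem⟩ - u)
    rw [map_sub, map_sub, hLg, sub_self, norm_zero, mul_zero] at h2
    exact sub_eq_zero.mp (norm_le_zero_iff.mp h2)

/-- From a bound on a quadratic form to a bound on its mixed term. -/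
theorem norm_inner_le_of_forall_norm_add_smul {x y : E} {a b : ℝ} (ha : 0 ≤ a) (hb : 0 ≤ b)
    (h : ∀ t : ℂ, ‖x + t • y‖ ^ 2 ≤ ‖x‖ ^ 2 + a ^ 2 + ‖t‖ ^ 2 * (‖y‖ ^ 2 + b ^ 2)) :
    ‖(inner ℂ x y : ℂ)‖ ≤ b * a := by
  set z : ℂ := inner ℂ x y with hz
  have key : ∀ s : ℝ, 0 ≤ (b ^ 2 * ‖z‖ ^ 2) * (s * s) + (-(2 * ‖z‖ ^ 2)) * s + a ^ 2 := fun s => by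
    -- This phase turns the cross term into s‖z‖², leaving a real quadratic in s whose discriminant
    -- is the claim.
    have h1 := h ((s : ℂ) * star z)
    rw [@norm_add_sq ℂ, inner_smul_right, ← hz, norm_smul, norm_mul, norm_star] at h1
    have h2 : RCLike.re ((s : ℂ) * star z * z) = s * ‖z‖ ^ 2 := by
      rw [mul_assoc, RCLike.star_def, Complex.conj_mul']
      norm_cast
    have h3 : ‖(s : ℂ)‖ ^ 2 = s ^ 2 := by simp
    rw [h2] at h1
    simp only [mul_pow, h3] at h1
    nlinarith
  have hd := discrim_le_zero key
  rw [discrim] at hd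
  rcases eq_or_ne ‖z‖ 0 with h0 | h0
  · rw [h0]; positivity
  · have hpos : 0 < ‖z‖ ^ 2 := by positivity
    have : ‖z‖ ^ 2 * ‖z‖ ^ 2 ≤ ‖z‖ ^ 2 * (b * a) ^ 2 := by nlinarith
    exact (sq_le_sq₀ (norm_nonneg _) (by positivity)).mp (le_of_mul_le_mul_left this hpos)

theorem starProjection_orthogonal_eq_of_sub_mem (N : Submodule ℂ E) [N.HasOrthogonalProjection]
    {x y : E} (h : x - y ∈ N) : Nᗮ.starProjection x = Nᗮ.starProjection y := by
  rw [← sub_eq_zero, ← map_sub]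
  exact N.starProjection_orthogonal_apply_eq_zero h

/-- The extension step of a row by row completion: if the part of `a` outside `N` is compatible
with the space `R`, then `a` can be corrected inside `N` to a unit vector orthogonal to `R`. -/
theorem exists_unit_mem_orthogonal (N R : Submodule ℂ E) [FiniteDimensional ℂ N]
    [FiniteDimensional ℂ R] (hdim : Module.finrank ℂ R < Module.finrank ℂ N) (a : E)
    (h : ∀ u ∈ R, ∀ t : ℂ, ‖Nᗮ.starProjection (u + t • a)‖ ^ 2 ≤ ‖u‖ ^ 2 + ‖t‖ ^ 2) :
    ∃ r ∈ Rᗮ, ‖r‖ = 1 ∧ r - a ∈ N := by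
  -- The part y of `a` outside N cannot be changed. The solution is y + v with v in N, ‖v‖ = b, and
  -- ⟪v, u⟫ = -⟪y, u⟫ on R.
  set y := Nᗮ.starProjection a with hy
  have hyN : y ∈ Nᗮ := Nᗮ.starProjection_apply_mem a
  have hy1 : ‖y‖ ^ 2 ≤ 1 := by
    have h1 := h 0 R.zero_mem 1
    rw [zero_add, one_smul, ← hy, norm_zero, norm_one] at h1
    linarith
  set b := √(1 - ‖y‖ ^ 2) with hb
  have hb2 : b ^ 2 = 1 - ‖y‖ ^ 2 := Real.sq_sqrt (by linarith)
  let L : R →ₗ[ℂ] N := N.orthogonalProjectionOnto.toLinearMap ∘ₗ R.subtype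
  have hL : ∀ u : R, (L u : E) = N.starProjection (u : E) := fun _ => rfl
  let f : R →ₗ[ℂ] ℂ := -(innerₛₗ ℂ y ∘ₗ R.subtype)
  have hf : ∀ u : R, f u = -inner ℂ y (u : E) := fun _ => rfl
  have hinner : ∀ u : E, (inner ℂ y u : ℂ) = inner ℂ y (Nᗮ.starProjection u) := fun u => by
    conv_lhs => rw [← N.starProjection_add_starProjection_orthogonal u, inner_add_right,
      Submodule.inner_left_of_mem_orthogonal (N.starProjection_apply_mem u) hyN, zero_add]
  -- Compatibility yields |⟪y, u⟫| ≤ b‖P_N u‖ on R, so the conditions on v have a solution in P_N R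
  -- of norm at most b.
  obtain ⟨u₀, hu₀, hu₀'⟩ := exists_mem_range_inner_eq L f b (Real.sqrt_nonneg _) fun u => by
    rw [hf, norm_neg, hinner, norm_inner_symm]
    refine norm_inner_le_of_forall_norm_add_smul (norm_nonneg _) (Real.sqrt_nonneg _) fun t => ?_
    have h1 := h u u.2 t
    rw [map_add, map_smul, Submodule.norm_sq_eq_add_norm_sq_starProjection (u : E) N] at h1
    rw [← hy] at h1
    have h2 : ‖L u‖ = ‖N.starProjection (u : E)‖ := by rw [← hL, Submodule.coe_norm]
    rw [h2, hb2]
    linarith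
  let Lw : N →ₗ[ℂ] R := R.orthogonalProjectionOnto.toLinearMap ∘ₗ N.subtype
  -- A nonzero w in N orthogonal to R is also orthogonal to L u₀. Adding a multiple of it raises the
  -- norm to b without affecting the inner products with R.
  obtain ⟨w, hw, hw0⟩ := (Submodule.ne_bot_iff _).mp (Lw.ker_ne_bot_of_finrank_lt hdim)
  have hwR : (w : E) ∈ Rᗮ := by
    rw [← R.starProjection_apply_eq_zero_iff]
    exact congrArg Subtype.val (LinearMap.mem_ker.mp hw)
  have hwn : ‖(w : E)‖ ≠ 0 := by simpa using hw0
  have hzw : (inner ℂ (L u₀ : E) (w : E) : ℂ) = 0 := by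
    rw [hL, N.inner_starProjection_left_eq_right, N.starProjection_eq_self_iff.mpr w.2]
    exact Submodule.inner_right_of_mem_orthogonal u₀.2 hwR
  have hzn : ‖(L u₀ : E)‖ ^ 2 ≤ 1 - ‖y‖ ^ 2 := by
    rw [← hb2]
    exact pow_le_pow_left₀ (norm_nonneg _) hu₀ 2
  set t : ℝ := √(1 - ‖y‖ ^ 2 - ‖(L u₀ : E)‖ ^ 2) / ‖(w : E)‖ with ht
  have ht2 : t ^ 2 * ‖(w : E)‖ ^ 2 = 1 - ‖y‖ ^ 2 - ‖(L u₀ : E)‖ ^ 2 := by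
    rw [ht, div_pow, Real.sq_sqrt (by linarith)]
    field_simp
  set v : E := (L u₀ : E) + (t : ℂ) • (w : E) with hv
  have hvN : v ∈ N := N.add_mem (L u₀).2 (N.smul_mem _ w.2)
  have hvn : ‖v‖ ^ 2 = 1 - ‖y‖ ^ 2 := by
    rw [hv, @norm_add_sq ℂ, inner_smul_right, hzw, norm_smul, mul_pow]
    simp only [mul_zero, map_zero, Complex.norm_real, Real.norm_eq_abs, sq_abs]
    linarith
  refine ⟨y + v, ?_, ?_, ?_⟩
  · rw [Submodule.mem_orthogonal']
    intro u hu
    have h1 := hu₀' ⟨u, hu⟩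
    rw [hf, Submodule.coe_inner, hL ⟨u, hu⟩, ← N.inner_starProjection_left_eq_right,
      N.starProjection_eq_self_iff.mpr (L u₀).2] at h1
    rw [inner_add_left, hv, inner_add_left, h1, inner_smul_left,
      Submodule.inner_left_of_mem_orthogonal hu hwR]
    simp
  · have : ‖y + v‖ ^ 2 = 1 := by
      rw [@norm_add_sq ℂ, Submodule.inner_left_of_mem_orthogonal hvN hyN, hvn]
      simp
    exact (pow_eq_one_iff_of_nonneg (norm_nonneg _) two_ne_zero).mp this
  · have h1 : y - a = -N.starProjection a := by
      rw [hy, eq_comm, neg_eq_iff_eq_neg, neg_sub, eq_sub_iff_add_eq]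
      exact N.starProjection_add_starProjection_orthogonal a
    rw [add_sub_right_comm, h1]
    exact N.add_mem (N.neg_mem (N.starProjection_apply_mem a)) hvN

/-- Existence of a sequence given by a rule which involves all the previous terms. -/
theorem exists_seq_of_extension {α : Type*} [Nonempty α] (p : ℕ → (ℕ → α) → α → Prop)
    (hp : ∀ n r r' a, (∀ j < n, r j = r' j) → p n r a → p n r' a)
    (h : ∀ n r, (∀ j < n, p j r (r j)) → ∃ a, p n r a) :
    ∃ r : ℕ → α, ∀ n, p n r (r n) := by
  classical
  -- The filler from index n on is harmless, because `hp` says that the rule reads only earlier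
  -- terms.
  let F : ∀ n : ℕ, (∀ j, j < n → α) → α := fun n f =>
    Classical.epsilon (p n fun j => if hj : j < n then f j hj else Classical.arbitrary α)
  let r : ℕ → α := fun n => Nat.strongRecOn (motive := fun _ => α) n F
  have hr : ∀ n, r n = F n fun j _ => r j := fun n => by
    simp only [r]
    rw [Nat.strongRecOn_eq]
  refine ⟨r, fun n => ?_⟩
  induction n using Nat.strong_induction_on with
  | _ n ih =>
    obtain ⟨a, ha⟩ := h n r ih
    have h1 := Classical.epsilon_spec
      (p := p n fun j => if hj : j < n then r j else Classical.arbitrary α)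
      ⟨a, hp n _ _ _ (fun j hj => by simp [hj]) ha⟩
    have h2 : p n (fun j => if hj : j < n then r j else Classical.arbitrary α) (r n) := by
      rw [hr n]; exact h1
    exact hp n _ _ _ (fun j hj => by simp [hj]) h2

theorem norm_sum_smul_sq_of_orthonormal {ι : Type*} {v : ι → E} (hv : Orthonormal ℂ v)
    (s : Finset ι) (c : ι → ℂ) : ‖∑ j ∈ s, c j • v j‖ ^ 2 = ∑ j ∈ s, ‖c j‖ ^ 2 := by
  have h1 := hv.inner_sum c c s
  rw [inner_self_eq_norm_sq_to_K] at h1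
  simp only [RCLike.conj_mul] at h1
  exact_mod_cast h1

/-- A sequence `a` can be corrected, with corrections in the spaces `N k`, to an orthonormal one. -/
theorem exists_orthonormal_sub_mem (N : ℕ → Submodule ℂ E) [∀ k, FiniteDimensional ℂ (N k)]
    (hN : Monotone N) (hdim : ∀ k, k < Module.finrank ℂ (N k)) (a : ℕ → E)
    (h : ∀ (k : ℕ) (c : ℕ → ℂ), ‖(N k)ᗮ.starProjection (∑ j ∈ Finset.range (k + 1), c j • a j)‖ ^ 2
      ≤ ∑ j ∈ Finset.range (k + 1), ‖c j‖ ^ 2) :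
    ∃ r : ℕ → E, Orthonormal ℂ r ∧ ∀ k, r k - a k ∈ N k := by
  classical
  obtain ⟨r, hr⟩ : ∃ r : ℕ → E, ∀ k, (∀ j < k, inner ℂ (r j) (r k) = (0 : ℂ)) ∧ ‖r k‖ = 1 ∧
      r k - a k ∈ N k := by
    refine exists_seq_of_extension (α := E)
      (fun k r b => (∀ j < k, inner ℂ (r j) b = (0 : ℂ)) ∧ ‖b‖ = 1 ∧ b - a k ∈ N k)
      (fun k r r' b hrr hp => ⟨fun j hj => hrr j hj ▸ hp.1 j hj, hp.2⟩)
      (fun k r hr => ?_)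
    let S : Finset E := (Finset.range k).image r
    have hS : Module.finrank ℂ (Submodule.span ℂ (S : Set E)) < Module.finrank ℂ (N k) :=
      ((finrank_span_finset_le_card S).trans
        (Finset.card_image_le.trans (Finset.card_range k).le)).trans_lt (hdim k)
    have hcompat : ∀ u ∈ Submodule.span ℂ (S : Set E), ∀ t : ℂ,
        ‖(N k)ᗮ.starProjection (u + t • a k)‖ ^ 2 ≤ ‖u‖ ^ 2 + ‖t‖ ^ 2 := by
      intro u hu t
      rw [Finset.coe_image, Submodule.mem_span_image_finset_iff_exists_fun'] at hu
      obtain ⟨c, rfl⟩ := hu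
      have hnorm : ‖∑ j ∈ Finset.range k, c j • r j‖ ^ 2 = ∑ j ∈ Finset.range k, ‖c j‖ ^ 2 := by
        have horth : Orthonormal ℂ fun j : Finset.range k => r j := by
          refine ⟨fun j => (hr j (Finset.mem_range.mp j.2)).2.1, ?_⟩
          rintro ⟨i, hi⟩ ⟨j, hj⟩ hij
          rcases lt_or_gt_of_ne (Subtype.coe_ne_coe.mpr hij) with hlt | hlt
          · exact (hr j (Finset.mem_range.mp hj)).1 i hlt
          · exact inner_eq_zero_symm.mp ((hr i (Finset.mem_range.mp hi)).1 j hlt)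
        have h1 := norm_sum_smul_sq_of_orthonormal horth Finset.univ fun j => c j
        rwa [Finset.sum_coe_sort (Finset.range k) (fun j => c j • r j),
          Finset.sum_coe_sort (Finset.range k) (fun j => ‖c j‖ ^ 2)] at h1
      let c' : ℕ → ℂ := Function.update c k t
      have hc' : ∀ j ∈ Finset.range k, c' j = c j := fun j hj =>
        Function.update_of_ne (Finset.mem_range.mp hj).ne _ _
      have hck : c' k = t := Function.update_self _ _ _
      have h1 := h k c'
      rw [Finset.sum_range_succ, Finset.sum_range_succ, hck,
        Finset.sum_congr rfl fun j hj => by rw [hc' j hj],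
        Finset.sum_congr (g := fun j => ‖c j‖ ^ 2) rfl fun j hj => by rw [hc' j hj]] at h1
      rw [hnorm]
      -- Each earlier r j differs from a j by an element of N j ≤ N k, so outside N k the two sums
      -- agree.
      refine le_of_eq_of_le (congrArg (fun z => ‖z‖ ^ 2) ?_) h1
      apply starProjection_orthogonal_eq_of_sub_mem
      rw [add_sub_add_right_eq_sub, ← Finset.sum_sub_distrib]
      refine Submodule.sum_mem _ fun j hj => ?_
      rw [← smul_sub]
      have hjk := Finset.mem_range.mp hj
      exact Submodule.smul_mem _ _ (hN hjk.le (hr j hjk).2.2)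
    obtain ⟨b, hb, hb1, hba⟩ :=
      exists_unit_mem_orthogonal (N k) (Submodule.span ℂ (S : Set E)) hS (a k) hcompat
    refine ⟨b, fun j hj => ?_, hb1, hba⟩
    exact Submodule.inner_right_of_mem_orthogonal
      (Submodule.subset_span (Finset.mem_coe.mpr
        (Finset.mem_image_of_mem r (Finset.mem_range.mpr hj)))) hb
  refine ⟨r, ⟨fun k => (hr k).2.1, ?_⟩, fun k => (hr k).2.2⟩
  intro i j hij
  rcases lt_or_gt_of_ne hij with hlt | hlt
  · exact (hr j).1 i hlt
  · exact inner_eq_zero_symm.mp ((hr i).1 j hlt)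

/-! ### Compactness along exhausting subspaces, and operator square roots -/

theorem eventually_norm_starProjection_orthogonal_lt (N : ℕ → Submodule ℂ E)
    [∀ k, FiniteDimensional ℂ (N k)] (hN : Monotone N) (hdense : Dense (⋃ k, (N k : Set E)))
    {ε : ℝ} (hε : 0 < ε) (z : E) : ∀ᶠ n in atTop, ‖(N n)ᗮ.starProjection z‖ < ε := by
  obtain ⟨v, hv, hzv⟩ := hdense.exists_dist_lt z hε
  obtain ⟨m, hm⟩ := Set.mem_iUnion.mp hv
  filter_upwards [eventually_ge_atTop m] with n hn
  rw [starProjection_orthogonal_eq_of_sub_mem (N n) (x := z) (y := z - v)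
    (by rw [sub_sub_cancel]; exact hN hn hm)]
  exact ((N n)ᗮ.norm_starProjection_apply_le _).trans_lt (by rwa [← dist_eq_norm])

variable [CompleteSpace E]

/-- The part of a compact operator outside of an exhausting sequence of subspaces is small. -/
theorem exists_norm_starProjection_orthogonal_adjoint_le {F : Type*} [NormedAddCommGroup F]
    [InnerProductSpace ℂ F] [CompleteSpace F] (K : E →L[ℂ] F) (hK : IsCompactOperator K)
    (N : ℕ → Submodule ℂ E) [∀ k, FiniteDimensional ℂ (N k)] (hN : Monotone N)
    (hdense : Dense (⋃ k, (N k : Set E))) {ε : ℝ} (hε : 0 < ε) :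
    ∃ n₀, ∀ n ≥ n₀, ∀ x : F, ‖(N n)ᗮ.starProjection (adjoint K x)‖ ≤ ε * ‖x‖ := by
  -- By ‖K⋆x‖² ≤ ‖KK⋆x‖‖x‖, a finite net for the image of the ball under KK⋆ also controls K⋆.
  have hT : IsCompactOperator (K ∘L adjoint K) := hK.comp_clm (adjoint K)
  have hsq : ∀ x : F, ‖adjoint K x‖ ^ 2 ≤ ‖(K ∘L adjoint K) x‖ * ‖x‖ := fun x => by
    rw [← @inner_self_eq_norm_sq ℂ, ContinuousLinearMap.adjoint_inner_left]
    refine (RCLike.re_le_norm _).trans ((norm_inner_le_norm _ _).trans (le_of_eq (mul_comm _ _)))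
  have htb : TotallyBounded ((K ∘L adjoint K) '' Metric.closedBall (0 : F) 1) :=
    ((hT.isCompact_closure_image_closedBall (f := (K ∘L adjoint K).toLinearMap) 1).totallyBounded).subset
      subset_closure
  -- Two points of the unit ball are at distance at most 2, and 2 · ε²/8 = (ε/2)².
  have hδ : 0 < ε ^ 2 / 8 := by positivity
  obtain ⟨t, hts, htf, ht⟩ := Metric.finite_approx_of_totallyBounded htb _ hδ
  obtain ⟨s, hs, hsf, rfl⟩ := (Set.exists_subset_image_finite_and).mp ⟨t, hts, htf, rfl⟩
  have hev : ∀ᶠ n in atTop, ∀ z ∈ s, ‖(N n)ᗮ.starProjection (adjoint K z)‖ < ε / 2 :=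
    (hsf.eventually_all).mpr fun z _ =>
      eventually_norm_starProjection_orthogonal_lt N hN hdense (half_pos hε) _
  obtain ⟨n₀, hn₀⟩ := eventually_atTop.mp hev
  refine ⟨n₀, fun n hn => ?_⟩
  have hball : ∀ x : F, ‖x‖ ≤ 1 → ‖(N n)ᗮ.starProjection (adjoint K x)‖ ≤ ε := fun x hx => by
    obtain ⟨y, ⟨z, hz, rfl⟩, hzx⟩ := Set.mem_iUnion₂.mp
      (ht ⟨x, by simpa using hx, rfl⟩)
    have hz1 : ‖z‖ ≤ 1 := by simpa using hs hz
    rw [Metric.mem_ball, dist_eq_norm, ← map_sub] at hzx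
    have h1 : ‖adjoint K (x - z)‖ ^ 2 ≤ (ε / 2) ^ 2 := by
      refine (hsq (x - z)).trans ?_
      have h2 : ‖x - z‖ ≤ 2 := (norm_sub_le _ _).trans (by linarith)
      nlinarith [norm_nonneg (x - z), norm_nonneg ((K ∘L adjoint K) (x - z))]
    have h3 : ‖adjoint K (x - z)‖ ≤ ε / 2 :=
      (sq_le_sq₀ (norm_nonneg _) (by positivity)).mp h1
    have h4 : adjoint K x = adjoint K z + adjoint K (x - z) := by rw [map_sub]; abel
    rw [h4, map_add]
    have h5 := ((N n)ᗮ.norm_starProjection_apply_le (adjoint K (x - z))).trans h3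
    exact (norm_add_le _ _).trans (by linarith [hn₀ n hn z hz])
  intro x
  have := ContinuousLinearMap.opNorm_le_of_unit_norm
    (f := (N n)ᗮ.starProjection ∘L adjoint K) hε.le fun x hx => hball x hx.le
  exact ((N n)ᗮ.starProjection ∘L adjoint K).le_of_opNorm_le this x

/-- An isometry which is, up to a compact operator, compatible with two exhausting sequences of
subspaces of the same finite dimensions is surjective. -/
theorem surjective_of_sub_mem {F : Type*} [NormedAddCommGroup F]
    [InnerProductSpace ℂ F] [CompleteSpace F] (K : E →L[ℂ] F) (hK : IsCompactOperator K)
    (N : ℕ → Submodule ℂ E) [∀ k, FiniteDimensional ℂ (N k)] (hN : Monotone N)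
    (hdense : Dense (⋃ k, (N k : Set E)))
    (M : ℕ → Submodule ℂ F) [∀ k, FiniteDimensional ℂ (M k)]
    (hdim : ∀ k, Module.finrank ℂ (M k) = Module.finrank ℂ (N k))
    (J : F →ₗᵢ[ℂ] E) (hJ : ∀ k, ∀ x ∈ M k, J x - adjoint K x ∈ N k) :
    Function.Surjective J := by
  intro w
  suffices hw : w ∈ closure (Set.range J) by
    rwa [J.isometry.isClosedEmbedding.isClosed_range.closure_eq] at hw
  refine Metric.mem_closure_iff.mpr fun ε hε => ?_
  -- The bound 1/2 makes L bounded below; the other one gives η‖x‖ ≤ 2η‖w‖ ≤ ε/2 for the approximate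
  -- preimage x.
  set η : ℝ := min (1 / 2) (ε / (4 * (‖w‖ + 1))) with hη
  have hw1 : 0 < ‖w‖ + 1 := by positivity
  have hη0 : 0 < η := lt_min (by norm_num) (by positivity)
  have hη1 : η ≤ 1 / 2 := min_le_left _ _
  have hη2 : η * (4 * (‖w‖ + 1)) ≤ ε := (le_div_iff₀ (by positivity)).mp (min_le_right _ _)
  obtain ⟨n₀, hn₀⟩ := exists_norm_starProjection_orthogonal_adjoint_le K hK N hN hdense hη0
  obtain ⟨n, hn, hwn⟩ := ((eventually_ge_atTop n₀).and
    (eventually_norm_starProjection_orthogonal_lt N hN hdense (half_pos hε) w)).exists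
  let L : M n →ₗ[ℂ] N n :=
    (N n).orthogonalProjectionOnto.toLinearMap ∘ₗ J.toLinearMap ∘ₗ (M n).subtype
  have hL : ∀ x : M n, (L x : E) = (N n).starProjection (J x) := fun _ => rfl
  have hsmall : ∀ x : M n, ‖(N n)ᗮ.starProjection (J x)‖ ≤ η * ‖(x : F)‖ := fun x => by
    rw [starProjection_orthogonal_eq_of_sub_mem (N n) (hJ n x x.2)]
    exact hn₀ n hn x
  have hbelow : ∀ x : M n, ‖(x : F)‖ ≤ 2 * ‖(L x : E)‖ := fun x => by
    have h1 : ‖(x : F)‖ ≤ ‖(L x : E)‖ + ‖(N n)ᗮ.starProjection (J x)‖ := by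
      rw [← J.norm_map, hL]
      conv_lhs => rw [← (N n).starProjection_add_starProjection_orthogonal (J x)]
      exact norm_add_le _ _
    nlinarith [hsmall x, norm_nonneg (x : F)]
  have hinj : Function.Injective L := (injective_iff_map_eq_zero L).mpr fun x hx => by
    have := hbelow x
    rw [hx, Submodule.coe_zero, norm_zero, mul_zero] at this
    exact Subtype.ext (norm_le_zero_iff.mp this)
  -- Equal dimensions turn the lower bound into exact solvability inside N n; only components
  -- outside N n remain to be estimated.
  obtain ⟨x, hx⟩ := (LinearMap.injective_iff_surjective_of_finrank_eq_finrank (hdim n)).mp hinj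
    ((N n).orthogonalProjectionOnto w)
  have hLx : (L x : E) = (N n).starProjection w := by rw [hx]; rfl
  have hxw : ‖(x : F)‖ ≤ 2 * ‖w‖ := by
    refine (hbelow x).trans ?_
    rw [hLx]
    gcongr
    exact (N n).norm_starProjection_apply_le w
  refine ⟨J x, ⟨x, rfl⟩, ?_⟩
  have h2 : w - J x = (N n)ᗮ.starProjection w - (N n)ᗮ.starProjection (J x) := by
    conv_lhs => rw [← (N n).starProjection_add_starProjection_orthogonal w,
      ← (N n).starProjection_add_starProjection_orthogonal (J x), ← hL, hLx]
    abel
  rw [dist_eq_norm, h2]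
  have h3 := norm_sub_le ((N n)ᗮ.starProjection w) ((N n)ᗮ.starProjection (J x))
  nlinarith [hsmall x, norm_nonneg w]

theorem adjoint_inv_of_isSelfAdjoint {D : (E →L[ℂ] E)ˣ} (hD : IsSelfAdjoint (D : E →L[ℂ] E)) :
    adjoint ((D⁻¹ : (E →L[ℂ] E)ˣ) : E →L[ℂ] E) = ((D⁻¹ : (E →L[ℂ] E)ˣ) : E →L[ℂ] E) := by
  have h : star D = D := Units.ext hD
  rw [← ContinuousLinearMap.star_eq_adjoint, ← Units.coe_star_inv, h]

/-- A multiple of the identity minus a square of smaller norm has an invertible square root. -/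
theorem exists_unit_norm_sq_eq {F : Type*} [NormedAddCommGroup F] [InnerProductSpace ℂ F]
    [CompleteSpace F] (B : E →L[ℂ] F) {μ : ℝ} (h : ‖B‖ < μ) :
    ∃ D : (E →L[ℂ] E)ˣ, IsSelfAdjoint (D : E →L[ℂ] E) ∧
      ∀ x, ‖(D : E →L[ℂ] E) x‖ ^ 2 = μ ^ 2 * ‖x‖ ^ 2 - ‖B x‖ ^ 2 := by
  have hμ : 0 < μ := (norm_nonneg B).trans_lt h
  let M : E →L[ℂ] E := ((μ : ℂ) ^ 2) • 1 - adjoint B ∘L B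
  have hMre : ∀ x, inner ℂ (M x) x = ((μ ^ 2 * ‖x‖ ^ 2 - ‖B x‖ ^ 2 : ℝ) : ℂ) := fun x => by
    simp only [M, sub_apply, smul_apply, one_apply_eq_self, ContinuousLinearMap.comp_apply,
      inner_sub_left, inner_smul_left, ContinuousLinearMap.adjoint_inner_left]
    rw [inner_self_eq_norm_sq_to_K, inner_self_eq_norm_sq_to_K]
    simp
  have hM0 : 0 ≤ M := by
    rw [ContinuousLinearMap.nonneg_iff_isPositive, ContinuousLinearMap.isPositive_iff_complex]
    intro x
    rw [hMre]
    refine ⟨by rw [RCLike.re_to_complex, Complex.ofReal_re], ?_⟩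
    have h1 := B.le_of_opNorm_le h.le x
    have h2 : ‖B x‖ ^ 2 ≤ (μ * ‖x‖) ^ 2 := pow_le_pow_left₀ (norm_nonneg _) h1 2
    simp only [RCLike.re_to_complex, Complex.ofReal_re]
    nlinarith
  have hMu : IsUnit M := by
    have hn : ‖((μ : ℂ) ^ 2)⁻¹ • (adjoint B ∘L B)‖ < 1 := by
      rw [norm_smul, ContinuousLinearMap.norm_adjoint_comp_self, norm_inv, norm_pow,
        Complex.norm_real, Real.norm_eq_abs, sq_abs, inv_mul_lt_one₀ (by positivity)]
      nlinarith [norm_nonneg B]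
    have hμ2 : (μ : ℂ) ^ 2 ≠ 0 := pow_ne_zero 2 (Complex.ofReal_ne_zero.mpr hμ.ne')
    have h1 : M = ((μ : ℂ) ^ 2) • (1 - ((μ : ℂ) ^ 2)⁻¹ • (adjoint B ∘L B)) := by
      rw [smul_sub, smul_inv_smul₀ hμ2]
    rw [h1]
    exact (isUnit_one_sub_of_norm_lt_one hn).smul (Units.mk0 _ hμ2)
  obtain ⟨D, hD⟩ := (CFC.isUnit_sqrt_iff M hM0).mpr hMu
  have hDs : IsSelfAdjoint (D : E →L[ℂ] E) := by
    rw [hD]; exact (CFC.sqrt_nonneg M).isSelfAdjoint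
  refine ⟨D, hDs, fun x => ?_⟩
  have h1 : (D : E →L[ℂ] E) ((D : E →L[ℂ] E) x) = M x := by
    rw [hD]
    exact DFunLike.congr_fun (CFC.sqrt_mul_sqrt_self M hM0) x
  have h2 := hMre x
  rw [← h1, ← hDs.adjoint_eq, ContinuousLinearMap.adjoint_inner_left, hDs.adjoint_eq,
    inner_self_eq_norm_sq_to_K] at h2
  rw [← RCLike.ofReal_pow] at h2
  exact Complex.ofReal_injective h2

end Hilbert

/-! ### Unit vectors, initial spaces and causality -/

/-- The unit vectors of `ℓ²`. -/
def unitVec (k : ℕ) : Ell2 := lp.single 2 k (1 : ℂ)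

theorem unitVec_apply (k j : ℕ) : unitVec k j = if j = k then 1 else 0 := by
  simp [unitVec, Pi.single_apply]

theorem inner_unitVec_left (k : ℕ) (x : Ell2) : inner ℂ (unitVec k) x = x k := by
  rw [unitVec, lp.inner_single_left]
  simp

theorem orthonormal_unitVec : Orthonormal ℂ unitVec := by
  rw [orthonormal_iff_ite]
  intro i j
  rw [inner_unitVec_left, unitVec_apply]

/-- The space of the sequences which vanish after the index `k`. -/
def initialSpace (k : ℕ) : Submodule ℂ Ell2 :=
  Submodule.span ℂ (Set.range fun i : Fin (k + 1) => unitVec i)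

instance (k : ℕ) : FiniteDimensional ℂ (initialSpace k) :=
  FiniteDimensional.span_of_finite ℂ (Set.finite_range _)

theorem finrank_initialSpace (k : ℕ) : Module.finrank ℂ (initialSpace k) = k + 1 := by
  rw [initialSpace, finrank_span_eq_card, Fintype.card_fin]
  exact orthonormal_unitVec.linearIndependent.comp _ Fin.val_injective

theorem truncation_eq_sum (k : ℕ) (x : Ell2) :
    truncation k x = ∑ i ∈ Finset.range (k + 1), x i • unitVec i := by
  ext j
  rw [truncation_apply, lp.coeFn_sum, Finset.sum_apply]
  simp [unitVec_apply]

theorem truncation_mem_initialSpace (k : ℕ) (x : Ell2) : truncation k x ∈ initialSpace k := by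
  rw [truncation_eq_sum]
  exact Submodule.sum_mem _ fun i hi => Submodule.smul_mem _ _
    (Submodule.subset_span ⟨⟨i, Finset.mem_range.mp hi⟩, rfl⟩)

theorem mem_initialSpace_iff {k : ℕ} {x : Ell2} : x ∈ initialSpace k ↔ truncation k x = x := by
  refine ⟨fun hx => ?_, fun hx => hx ▸ truncation_mem_initialSpace k x⟩
  induction hx using Submodule.span_induction with
  | mem x hx =>
    obtain ⟨i, rfl⟩ := hx
    ext j
    rw [truncation_apply, ite_eq_left_iff, unitVec_apply]
    intro hj
    rw [if_neg]
    have := i.2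
    omega
  | zero => exact map_zero _
  | add x y _ _ hx hy => rw [map_add, hx, hy]
  | smul c x _ hx => rw [map_smul, hx]

theorem initialSpace_mono : Monotone initialSpace := fun i j hij =>
  Submodule.span_mono (Set.range_subset_iff.mpr fun l => ⟨⟨l, by omega⟩, rfl⟩)

theorem dense_iUnion_initialSpace : Dense (⋃ k, (initialSpace k : Set Ell2)) := fun x => by
  have h := (lp.hasSum_single (p := 2) (by norm_num) x).tendsto_sum_nat
  refine mem_closure_of_tendsto h (Eventually.of_forall fun n => ?_)
  refine Set.mem_iUnion.mpr ⟨n, Submodule.sum_mem _ fun i hi => ?_⟩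
  have : lp.single 2 i (x i) = x i • unitVec i := by
    rw [unitVec, ← lp.single_smul, smul_eq_mul, mul_one]
  rw [this]
  exact Submodule.smul_mem _ _
    (Submodule.subset_span ⟨⟨i, (Finset.mem_range.mp hi).trans n.lt_succ_self⟩, rfl⟩)

theorem adjoint_truncation (k : ℕ) : adjoint (truncation k) = truncation k := by
  refine ((ContinuousLinearMap.eq_adjoint_iff _ _).mpr fun x y => ?_).symm
  rw [lp.inner_eq_tsum, lp.inner_eq_tsum]
  refine tsum_congr fun j => ?_
  rw [truncation_apply, truncation_apply]
  split_ifs <;> simp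

/-- The adjoint of a lower triangular matrix is upper triangular. In this form causality becomes a
condition on the flag of initial spaces. -/
theorem isCausal_iff_adjoint_mem {Q : Ell2 →L[ℂ] Ell2} :
    IsCausal Q ↔ ∀ k, ∀ x ∈ initialSpace k, adjoint Q x ∈ initialSpace k := by
  have h : ∀ k, truncation k ∘L Q ∘L truncation k = truncation k ∘L Q ↔
      truncation k ∘L adjoint Q ∘L truncation k = adjoint Q ∘L truncation k := fun k => by
    rw [← adjoint.injective.eq_iff]
    simp only [ContinuousLinearMap.adjoint_comp, adjoint_truncation,
      ContinuousLinearMap.comp_assoc]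
  refine forall_congr' fun k => (h k).trans ⟨fun hk x hx => ?_, fun hk => ?_⟩
  · have := DFunLike.congr_fun hk x
    simp only [ContinuousLinearMap.comp_apply, mem_initialSpace_iff.mp hx] at this
    exact mem_initialSpace_iff.mpr this
  · ext1 x
    exact mem_initialSpace_iff.mp (hk _ (truncation_mem_initialSpace k x))

/-! ### Causal completion with prescribed absolute value -/

/-- A compact operator can be changed by a causal operator into an operator with the prescribed
absolute value `D`, as soon as its parts above the diagonal are contractive relative to `D`. -/
theorem exists_causal_norm_sub_eq (A : Ell2 →L[ℂ] Ell2) (hA : IsCompactOperator A)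
    (D : (Ell2 →L[ℂ] Ell2)ˣ) (hD : IsSelfAdjoint (D : Ell2 →L[ℂ] Ell2))
    (h : ∀ k, ∀ v ∈ initialSpace k,
      ‖((initialSpace k).map ((D⁻¹ : (Ell2 →L[ℂ] Ell2)ˣ) : Ell2 →L[ℂ] Ell2).toLinearMap)ᗮ.starProjection
        (((D⁻¹ : (Ell2 →L[ℂ] Ell2)ˣ) : Ell2 →L[ℂ] Ell2) (adjoint A v))‖ ≤ ‖v‖) :
    ∃ Q : Ell2 →L[ℂ] Ell2, IsCausal Q ∧ ∀ x, ‖(A - Q) x‖ = ‖(D : Ell2 →L[ℂ] Ell2) x‖ := by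
  set Di : Ell2 →L[ℂ] Ell2 := ((D⁻¹ : (Ell2 →L[ℂ] Ell2)ˣ) : Ell2 →L[ℂ] Ell2) with hDi
  have hDDi : ∀ x, (D : Ell2 →L[ℂ] Ell2) (Di x) = x := fun x =>
    DFunLike.congr_fun (D.mul_inv) x
  have hDiD : ∀ x, Di ((D : Ell2 →L[ℂ] Ell2) x) = x := fun x =>
    DFunLike.congr_fun (D.inv_mul) x
  have hDia : adjoint Di = Di := adjoint_inv_of_isSelfAdjoint hD
  let N : ℕ → Submodule ℂ Ell2 := fun k => (initialSpace k).map Di.toLinearMap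
  have hNmono : Monotone N := fun i j hij => Submodule.map_mono (initialSpace_mono hij)
  have hDiinj : Function.Injective Di := Function.LeftInverse.injective hDDi
  have hfr : ∀ k, Module.finrank ℂ (N k) = k + 1 := fun k => by
    rw [← finrank_initialSpace k]
    exact (Submodule.equivMapOfInjective Di.toLinearMap hDiinj (initialSpace k)).finrank_eq.symm
  have hdense : Dense (⋃ k, (N k : Set Ell2)) := by
    have h1 : Dense (Di '' ⋃ k, (initialSpace k : Set Ell2)) :=
      (Function.RightInverse.surjective hDiD).denseRange.dense_image Di.continuous
        dense_iUnion_initialSpace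
    rwa [Set.image_iUnion] at h1
  have hK : IsCompactOperator (A ∘L Di) := hA.comp_clm Di
  have hKa : ∀ x, adjoint (A ∘L Di) x = Di (adjoint A x) := fun x => by
    rw [ContinuousLinearMap.adjoint_comp, hDia]; rfl
  obtain ⟨r, hr, hra⟩ := exists_orthonormal_sub_mem N hNmono (fun k => by rw [hfr]; omega)
    (fun j => adjoint (A ∘L Di) (unitVec j)) fun k c => by
      rw [← norm_sum_smul_sq_of_orthonormal orthonormal_unitVec]
      have hv : ∑ j ∈ Finset.range (k + 1), c j • unitVec j ∈ initialSpace k :=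
        Submodule.sum_mem _ fun i hi => Submodule.smul_mem _ _
          (Submodule.subset_span ⟨⟨i, Finset.mem_range.mp hi⟩, rfl⟩)
      have hsum : ∑ j ∈ Finset.range (k + 1), c j • adjoint (A ∘L Di) (unitVec j) =
          Di (adjoint A (∑ j ∈ Finset.range (k + 1), c j • unitVec j)) := by
        rw [← hKa, map_sum]
        simp only [map_smul]
      rw [hsum]
      exact pow_le_pow_left₀ (norm_nonneg _) (h k _ hv) 2
  let J : Ell2 →ₗᵢ[ℂ] Ell2 := hr.orthogonalFamily.linearIsometry
  have hJe : ∀ k, J (unitVec k) = r k := fun k => by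
    simp [J, unitVec, OrthogonalFamily.linearIsometry_apply_single]
  have hJN : ∀ k, ∀ x ∈ initialSpace k, J x - adjoint (A ∘L Di) x ∈ N k := fun k x hx => by
    induction hx using Submodule.span_induction with
    | mem x hx =>
      obtain ⟨i, rfl⟩ := hx
      simp only [hJe]
      exact hNmono (Nat.lt_succ_iff.mp i.2) (hra i)
    | zero => simp
    | add x y _ _ hx hy =>
      rw [map_add, map_add, add_sub_add_comm]
      exact add_mem hx hy
    | smul c x _ hx =>
      rw [map_smul, map_smul, ← smul_sub]
      exact Submodule.smul_mem _ _ hx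
  have hJsurj : Function.Surjective J := surjective_of_sub_mem (A ∘L Di) hK N hNmono hdense
    initialSpace (fun k => by rw [hfr, finrank_initialSpace]) J hJN
  let Jc : Ell2 →L[ℂ] Ell2 := J.toContinuousLinearMap
  have hJJ : ∀ x, adjoint Jc (J x) = x := fun x => by
    refine ext_inner_left ℂ fun y => ?_
    rw [ContinuousLinearMap.adjoint_inner_right]
    exact J.inner_map_map y x
  -- Here Q⋆x = A⋆x - DJx = -D(Jx - D⁻¹A⋆x), and D maps N k back to the initial space. The norm
  -- identity needs J onto, so that J⋆ is isometric.
  refine ⟨A - adjoint Jc ∘L (D : Ell2 →L[ℂ] Ell2), ?_, fun x => ?_⟩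
  · refine isCausal_iff_adjoint_mem.mpr fun k x hx => ?_
    obtain ⟨y, hy, hyx⟩ := hJN k x hx
    have h1 : adjoint (A - adjoint Jc ∘L (D : Ell2 →L[ℂ] Ell2)) x = -y := by
      rw [map_sub, ContinuousLinearMap.adjoint_comp, ContinuousLinearMap.adjoint_adjoint,
        hD.adjoint_eq]
      have h2 : y = (D : Ell2 →L[ℂ] Ell2) (J x - adjoint (A ∘L Di) x) := by
        rw [← hyx]; exact (hDDi y).symm
      rw [h2, map_sub, hKa, hDDi, neg_sub]
      rfl
    rw [h1]
    exact neg_mem hy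
  · rw [sub_sub_cancel]
    obtain ⟨y, hy⟩ := hJsurj ((D : Ell2 →L[ℂ] Ell2) x)
    rw [ContinuousLinearMap.comp_apply, ← hy, hJJ, J.norm_map]

/-! ### Splitting of the error and existence of an allpass optimum -/

theorem norm_column_sq (B₁ B₂ : Ell2 →L[ℂ] Ell2) (x : Ell2) :
    ‖column B₁ B₂ x‖ ^ 2 = ‖B₁ x‖ ^ 2 + ‖B₂ x‖ ^ 2 := by
  rw [WithLp.prod_norm_sq_eq_of_L2]
  rfl

/-- Dividing R by its spectral factor normalizes it: Λ⁻⋆R⋆RΛ⁻¹ = I. -/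
theorem IsNormalizedFactor.adjoint_comp_self {W V P : Ell2 →L[ℂ] Ell2} {R₂ : Ell2 →L[ℂ] Ell2Sq}
    (h : IsNormalizedFactor W V P R₂) : adjoint R₂ ∘L R₂ = ContinuousLinearMap.id ℂ Ell2 := by
  obtain ⟨-, -, -, Λ₁, G, Λ, U₁, R, -, -, -, -, -, -, -, hR, rfl⟩ := h
  set Λi : Ell2 →L[ℂ] Ell2 := ((Λ⁻¹ : (Ell2 →L[ℂ] Ell2)ˣ) : Ell2 →L[ℂ] Ell2) with hΛi
  have h1 : (Λ : Ell2 →L[ℂ] Ell2) ∘L Λi = ContinuousLinearMap.id ℂ Ell2 := Λ.mul_inv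
  calc adjoint (R ∘L Λi) ∘L R ∘L Λi = adjoint Λi ∘L (adjoint R ∘L R) ∘L Λi := by
        rw [ContinuousLinearMap.adjoint_comp]; rfl
    _ = adjoint ((Λ : Ell2 →L[ℂ] Ell2) ∘L Λi) ∘L (Λ : Ell2 →L[ℂ] Ell2) ∘L Λi := by
        rw [hR, ContinuousLinearMap.adjoint_comp]; rfl
    _ = ContinuousLinearMap.id ℂ Ell2 := by
        rw [h1, ContinuousLinearMap.adjoint_id]; rfl

theorem muCausal_le (T₁ R₂ : Ell2 →L[ℂ] Ell2Sq) {Q : Ell2 →L[ℂ] Ell2} (hQ : IsCausal Q) :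
    muCausal T₁ R₂ ≤ ‖T₁ - R₂ ∘L Q‖ :=
  ciInf_le (f := fun Q : {Q : Ell2 →L[ℂ] Ell2 // IsCausal Q} => ‖T₁ - R₂ ∘L (Q : Ell2 →L[ℂ] Ell2)‖)
    ⟨0, by rintro _ ⟨Q, rfl⟩; exact norm_nonneg _⟩ ⟨Q, hQ⟩

theorem isCausal_zero : IsCausal (0 : Ell2 →L[ℂ] Ell2) := fun k => by simp

theorem exists_causal_norm_lt (T₁ R₂ : Ell2 →L[ℂ] Ell2Sq) {ν : ℝ} (h : muCausal T₁ R₂ < ν) :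
    ∃ Q, IsCausal Q ∧ ‖T₁ - R₂ ∘L Q‖ < ν := by
  have : Nonempty {Q : Ell2 →L[ℂ] Ell2 // IsCausal Q} := ⟨⟨0, isCausal_zero⟩⟩
  obtain ⟨Q, hQ⟩ := exists_lt_of_ciInf_lt h
  exact ⟨Q, Q.2, hQ⟩

theorem le_muCausal {T₁ R₂ : Ell2 →L[ℂ] Ell2Sq} {ν : ℝ}
    (h : ∀ Q, IsCausal Q → ν ≤ ‖T₁ - R₂ ∘L Q‖) : ν ≤ muCausal T₁ R₂ := by
  have : Nonempty {Q : Ell2 →L[ℂ] Ell2 // IsCausal Q} := ⟨⟨0, isCausal_zero⟩⟩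
  exact le_ciInf fun Q => h Q Q.2

theorem le_muCompact {T₁ R₂ : Ell2 →L[ℂ] Ell2Sq} {ν : ℝ}
    (h : ∀ Q, ν ≤ ‖T₁ - R₂ ∘L Q‖) : ν ≤ muCompact T₁ R₂ := by
  have : Nonempty {Q : Ell2 →L[ℂ] Ell2 // IsCompactOperator Q} := ⟨⟨0, isCompactOperator_zero⟩⟩
  exact le_ciInf fun Q => h Q

/-- The error splits into its part in the range of an isometry and the part orthogonal to it. -/
theorem norm_sub_comp_apply_sq {T₁ R₂ : Ell2 →L[ℂ] Ell2Sq}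
    (hR : adjoint R₂ ∘L R₂ = ContinuousLinearMap.id ℂ Ell2) (Q : Ell2 →L[ℂ] Ell2) (x : Ell2) :
    ‖(T₁ - R₂ ∘L Q) x‖ ^ 2 = ‖(adjoint R₂ ∘L T₁ - Q) x‖ ^ 2 +
      ‖(T₁ - R₂ ∘L adjoint R₂ ∘L T₁) x‖ ^ 2 := by
  have hR' : ∀ y, adjoint R₂ (R₂ y) = y := fun y => DFunLike.congr_fun hR y
  have hiso : ∀ y, ‖R₂ y‖ = ‖y‖ := (ContinuousLinearMap.norm_map_iff_adjoint_comp_self R₂).mpr hR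
  have h1 : (T₁ - R₂ ∘L Q) x = R₂ ((adjoint R₂ ∘L T₁ - Q) x) +
      (T₁ - R₂ ∘L adjoint R₂ ∘L T₁) x := by
    simp
  have h2 : inner ℂ (R₂ ((adjoint R₂ ∘L T₁ - Q) x)) ((T₁ - R₂ ∘L adjoint R₂ ∘L T₁) x)
      = (0 : ℂ) := by
    rw [← ContinuousLinearMap.adjoint_inner_right]
    simp [hR']
  rw [h1, @norm_add_sq ℂ, h2, hiso]
  simp

theorem isPartialIsometry_of_norm_eq {H K : Type*} [NormedAddCommGroup H] [InnerProductSpace ℂ H]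
    [NormedAddCommGroup K] [InnerProductSpace ℂ K] {A : H →L[ℂ] K} (h : ∀ x, ‖A x‖ = ‖x‖) :
    IsPartialIsometry A := fun u _ => h u

/-- If the causal distance exceeds the compact one, some optimum is allpass. -/
theorem exists_isOptimal_isPartialIsometry {T₁ R₂ : Ell2 →L[ℂ] Ell2Sq}
    (hR : adjoint R₂ ∘L R₂ = ContinuousLinearMap.id ℂ Ell2) (hT : IsCompactOperator T₁)
    (hμ : muCompact T₁ R₂ < muCausal T₁ R₂) :
    ∃ Q₀, IsOptimal T₁ R₂ Q₀ ∧ IsPartialIsometry (normalizedError T₁ R₂ Q₀) := by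
  set μ := muCausal T₁ R₂ with hμdef
  set A := adjoint R₂ ∘L T₁ with hA
  set B := T₁ - R₂ ∘L adjoint R₂ ∘L T₁ with hB
  have hBQ : ∀ Q, ‖B‖ ≤ ‖T₁ - R₂ ∘L Q‖ := fun Q =>
    B.opNorm_le_bound (norm_nonneg _) fun x => by
      refine le_trans ?_ ((T₁ - R₂ ∘L Q).le_opNorm x)
      refine (sq_le_sq₀ (norm_nonneg _) (norm_nonneg _)).mp ?_
      rw [norm_sub_comp_apply_sq hR Q, ← hB]
      linarith [sq_nonneg ‖(adjoint R₂ ∘L T₁ - Q) x‖]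
  have hBμ : ‖B‖ < μ := (le_muCompact hBQ).trans_lt hμ
  have hμ0 : 0 < μ := (norm_nonneg _).trans_lt hBμ
  obtain ⟨D, hD, hDn⟩ := exists_unit_norm_sq_eq B hBμ
  set Di : Ell2 →L[ℂ] Ell2 := ((D⁻¹ : (Ell2 →L[ℂ] Ell2)ˣ) : Ell2 →L[ℂ] Ell2) with hDi
  obtain ⟨Q, hQ, hQn⟩ := exists_causal_norm_sub_eq A (hT.clm_comp (adjoint R₂)) D hD
    fun k v hv => by
      -- If ‖T₁ - R₂Q‖ < ν, then ‖(A - Q)D⁻¹y‖² ≤ ‖y‖² + (ν² - μ²)‖D⁻¹y‖². The required contraction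
      -- is the limit ν ↓ μ, so an optimum need not be known to exist.
      set f : ℝ → ℝ := fun ν => √(1 + (ν ^ 2 - μ ^ 2) * ‖Di‖ ^ 2) * ‖v‖ with hf
      have hlim : Tendsto f (𝓝[>] μ) (𝓝 (f μ)) :=
        (Continuous.tendsto (by fun_prop) μ).mono_left nhdsWithin_le_nhds
      have hfμ : f μ = ‖v‖ := by simp [hf]
      rw [← hfμ]
      refine ge_of_tendsto hlim (eventually_mem_nhdsWithin.mono fun ν hν => ?_)
      rw [Set.mem_Ioi] at hν
      obtain ⟨Q, hQ, hQν⟩ := exists_causal_norm_lt T₁ R₂ hν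
      have hnorm : ‖(A - Q) ∘L Di‖ ≤ √(1 + (ν ^ 2 - μ ^ 2) * ‖Di‖ ^ 2) := by
        refine ContinuousLinearMap.opNorm_le_bound _ (Real.sqrt_nonneg _) fun y => ?_
        have hpos : 0 ≤ ν ^ 2 - μ ^ 2 := by nlinarith
        refine (sq_le_sq₀ (norm_nonneg _) (by positivity)).mp ?_
        rw [mul_pow, Real.sq_sqrt (by positivity)]
        have h1 := norm_sub_comp_apply_sq (T₁ := T₁) hR Q (Di y)
        have h2 : ‖(T₁ - R₂ ∘L Q) (Di y)‖ ^ 2 ≤ (ν * ‖Di y‖) ^ 2 :=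
          pow_le_pow_left₀ (norm_nonneg _) ((T₁ - R₂ ∘L Q).le_of_opNorm_le hQν.le _) 2
        have h3 := hDn (Di y)
        have h4 : (D : Ell2 →L[ℂ] Ell2) (Di y) = y := DFunLike.congr_fun D.mul_inv y
        rw [h4] at h3
        have h5 : ‖Di y‖ ^ 2 ≤ (‖Di‖ * ‖y‖) ^ 2 :=
          pow_le_pow_left₀ (norm_nonneg _) (Di.le_opNorm y) 2
        have h6 := mul_le_mul_of_nonneg_left h5 hpos
        rw [ContinuousLinearMap.comp_apply]
        nlinarith
      -- Causality of Q puts D⁻¹Q⋆v in N k, so A may be replaced by A - Q outside N k.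
      rw [starProjection_orthogonal_eq_of_sub_mem _ (y := adjoint ((A - Q) ∘L Di) v)]
      · refine (Submodule.norm_starProjection_apply_le _ _).trans ?_
        refine ContinuousLinearMap.le_of_opNorm_le _ ?_ v
        rwa [LinearIsometryEquiv.norm_map]
      · refine ⟨adjoint Q v, isCausal_iff_adjoint_mem.mp hQ k v hv, ?_⟩
        have h1 : adjoint ((A - Q) ∘L Di) v = Di (adjoint A v) - Di (adjoint Q v) := by
          rw [ContinuousLinearMap.adjoint_comp, adjoint_inv_of_isSelfAdjoint hD,
            map_sub adjoint A Q]
          exact map_sub Di _ _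
        rw [h1, sub_sub_cancel]
        rfl
  have hiso : ∀ x, ‖(T₁ - R₂ ∘L Q) x‖ = μ * ‖x‖ := fun x => by
    refine (sq_eq_sq₀ (norm_nonneg _) (by positivity)).mp ?_
    rw [norm_sub_comp_apply_sq hR, hQn, hDn]
    ring
  refine ⟨Q, ⟨hQ, le_antisymm ?_ (muCausal_le T₁ R₂ hQ)⟩, isPartialIsometry_of_norm_eq fun x => ?_⟩
  · exact ContinuousLinearMap.opNorm_le_bound _ hμ0.le fun x => (hiso x).le
  · rw [normalizedError, smul_apply, norm_smul, hiso, ← hμdef]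
    simp [abs_of_pos hμ0, hμ0.ne']

/-! ### Entrywise causality, diagonal operators and the gapped shift -/

theorem IsCausal.apply_eq_zero {A : Ell2 →L[ℂ] Ell2} (hA : IsCausal A) {k : ℕ} {x : Ell2}
    (hx : ∀ j ≤ k, x j = 0) : A x k = 0 := by
  have h0 : truncation k x = 0 := by
    ext j
    rw [truncation_apply]
    split_ifs with h
    · exact hx j h
    · rfl
  have h1 := congrArg (fun y : Ell2 => y k) (DFunLike.congr_fun (hA k) x)
  simp only [ContinuousLinearMap.comp_apply, h0, map_zero, truncation_apply, le_refl,
    if_true] at h1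
  exact h1.symm

theorem isCausal_of_apply_eq_zero {A : Ell2 →L[ℂ] Ell2}
    (h : ∀ k x, (∀ j ≤ k, x j = 0) → A x k = 0) : IsCausal A := fun k => by
  ext x j
  simp only [ContinuousLinearMap.comp_apply, truncation_apply]
  split_ifs with hj
  · have h1 : A (x - truncation k x) j = 0 := h j _ fun i hi => by
      rw [lp.coeFn_sub, Pi.sub_apply, truncation_apply, if_pos (hi.trans hj), sub_self]
    rw [map_sub, lp.coeFn_sub, Pi.sub_apply] at h1
    exact (sub_eq_zero.mp h1).symm
  · rfl

theorem IsCausal.comp {A B : Ell2 →L[ℂ] Ell2} (hA : IsCausal A) (hB : IsCausal B) :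
    IsCausal (A ∘L B) :=
  isCausal_of_apply_eq_zero fun _ _ hx =>
    hA.apply_eq_zero fun _ hj => hB.apply_eq_zero fun i hi => hx i (hi.trans hj)

theorem isCausal_id : IsCausal (ContinuousLinearMap.id ℂ Ell2) :=
  isCausal_of_apply_eq_zero fun k _ hx => hx k le_rfl

/-- The diagonal operator with the entries `a, b, c, c, c, …`. -/
def eventuallyConstDiag (a b c : ℂ) : Ell2 →L[ℂ] Ell2 :=
  c • ContinuousLinearMap.id ℂ Ell2 + (a - b) • truncation 0 + (b - c) • truncation 1

theorem eventuallyConstDiag_apply (a b c : ℂ) (x : Ell2) (j : ℕ) :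
    eventuallyConstDiag a b c x j = (if j = 0 then a else if j = 1 then b else c) * x j := by
  simp only [eventuallyConstDiag, add_apply, smul_apply, ContinuousLinearMap.id_apply,
    lp.coeFn_add, lp.coeFn_smul, Pi.add_apply, Pi.smul_apply, truncation_apply, smul_eq_mul]
  rcases j with _ | _ | j
  · simp; ring
  · simp; ring
  · simp

theorem isCausal_eventuallyConstDiag (a b c : ℂ) : IsCausal (eventuallyConstDiag a b c) :=
  isCausal_of_apply_eq_zero fun k x hx => by
    rw [eventuallyConstDiag_apply, hx k le_rfl, mul_zero]

theorem adjoint_eventuallyConstDiag (a b c : ℂ) :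
    adjoint (eventuallyConstDiag a b c) = eventuallyConstDiag (star a) (star b) (star c) := by
  refine ((ContinuousLinearMap.eq_adjoint_iff _ _).mpr fun x y => ?_).symm
  rw [lp.inner_eq_tsum, lp.inner_eq_tsum]
  refine tsum_congr fun j => ?_
  rw [eventuallyConstDiag_apply, eventuallyConstDiag_apply]
  split_ifs <;> simp <;> ring

theorem eventuallyConstDiag_comp (a b c a' b' c' : ℂ) :
    eventuallyConstDiag a b c ∘L eventuallyConstDiag a' b' c' =
      eventuallyConstDiag (a * a') (b * b') (c * c') := by
  ext x j
  simp only [ContinuousLinearMap.comp_apply, eventuallyConstDiag_apply]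
  split_ifs <;> ring

theorem eventuallyConstDiag_add (a b c a' b' c' : ℂ) :
    eventuallyConstDiag a b c + eventuallyConstDiag a' b' c' =
      eventuallyConstDiag (a + a') (b + b') (c + c') := by
  ext x j
  simp only [add_apply, lp.coeFn_add, Pi.add_apply, eventuallyConstDiag_apply]
  split_ifs <;> ring

theorem eventuallyConstDiag_one : eventuallyConstDiag 1 1 1 = ContinuousLinearMap.id ℂ Ell2 := by
  ext x j
  simp [eventuallyConstDiag_apply]

theorem eventuallyConstDiag_unitVec (a b c : ℂ) (k : ℕ) :
    eventuallyConstDiag a b c (unitVec k) =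
      (if k = 0 then a else if k = 1 then b else c) • unitVec k := by
  ext j
  rw [eventuallyConstDiag_apply, lp.coeFn_smul, Pi.smul_apply, unitVec_apply, smul_eq_mul]
  split_ifs <;> simp_all

/-- With zero tail the operator factors through the finite dimensional `initialSpace 1`. -/
theorem isCompactOperator_eventuallyConstDiag (a b : ℂ) :
    IsCompactOperator (eventuallyConstDiag a b 0) := by
  have h : eventuallyConstDiag a b 0 = eventuallyConstDiag a b 0 ∘L
      ((initialSpace 1).subtypeL ∘L (truncation 1).codRestrict (initialSpace 1)
        (truncation_mem_initialSpace 1)) := by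
    ext x j
    simp only [ContinuousLinearMap.comp_apply, eventuallyConstDiag_apply, Submodule.subtypeL_apply,
      ContinuousLinearMap.coe_codRestrict_apply, truncation_apply]
    rcases j with _ | _ | j <;> simp
  rw [h]
  have h1 : IsCompactOperator ((truncation 1).codRestrict (initialSpace 1)
      (truncation_mem_initialSpace 1)) :=
    isCompactOperator_of_locallyCompactSpace_dom _
  exact (h1.clm_comp (initialSpace 1).subtypeL).clm_comp (eventuallyConstDiag a b 0)

/-- An invertible diagonal operator as a unit. -/
def eventuallyConstDiagUnit (a b c : ℂ) (ha : a ≠ 0) (hb : b ≠ 0) (hc : c ≠ 0) :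
    (Ell2 →L[ℂ] Ell2)ˣ where
  val := eventuallyConstDiag a b c
  inv := eventuallyConstDiag a⁻¹ b⁻¹ c⁻¹
  val_inv := by
    refine (eventuallyConstDiag_comp _ _ _ _ _ _).trans ?_
    rw [mul_inv_cancel₀ ha, mul_inv_cancel₀ hb, mul_inv_cancel₀ hc, eventuallyConstDiag_one]
    rfl
  inv_val := by
    refine (eventuallyConstDiag_comp _ _ _ _ _ _).trans ?_
    rw [inv_mul_cancel₀ ha, inv_mul_cancel₀ hb, inv_mul_cancel₀ hc, eventuallyConstDiag_one]
    rfl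

theorem isCausalUnit_eventuallyConstDiagUnit (a b c : ℂ) (ha : a ≠ 0) (hb : b ≠ 0) (hc : c ≠ 0) :
    IsCausalUnit (eventuallyConstDiagUnit a b c ha hb hc) :=
  ⟨isCausal_eventuallyConstDiag _ _ _, isCausal_eventuallyConstDiag _ _ _⟩

theorem isCausalUnit_one : IsCausalUnit 1 := ⟨isCausal_id, isCausal_id⟩

/-- The normalized factor of two weights for the plant `Λ₁⁻¹ U` with a causal isometry `U`. -/
theorem isNormalizedFactor_of_isometry {W V : Ell2 →L[ℂ] Ell2} {Λ₁ : (Ell2 →L[ℂ] Ell2)ˣ}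
    (hW : IsCausal W) (hV : IsCausal V) (hΛ : IsCausalUnit Λ₁)
    (hfac : adjoint (Λ₁ : Ell2 →L[ℂ] Ell2) ∘L (Λ₁ : Ell2 →L[ℂ] Ell2)
      = adjoint W ∘L W + adjoint V ∘L V)
    {U : Ell2 →L[ℂ] Ell2} (hU : IsCausal U) (hUn : ∀ x, ‖U x‖ = ‖x‖) :
    IsNormalizedFactor W V (((Λ₁⁻¹ : (Ell2 →L[ℂ] Ell2)ˣ) : Ell2 →L[ℂ] Ell2) ∘L U)
      (column W V ∘L ((Λ₁⁻¹ : (Ell2 →L[ℂ] Ell2)ˣ) : Ell2 →L[ℂ] Ell2) ∘L U) := by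
  have hUU : adjoint U ∘L U = ContinuousLinearMap.id ℂ Ell2 :=
    (ContinuousLinearMap.norm_map_iff_adjoint_comp_self U).mp hUn
  set Λi : Ell2 →L[ℂ] Ell2 := ((Λ₁⁻¹ : (Ell2 →L[ℂ] Ell2)ˣ) : Ell2 →L[ℂ] Ell2) with hΛi
  have hinv : ∀ x, (Λ₁ : Ell2 →L[ℂ] Ell2) (Λi x) = x := DFunLike.congr_fun Λ₁.mul_inv
  -- For the plant Λ₁⁻¹U the outer factor is 1, and R is already isometric, so Λ = 1 too.
  refine ⟨hW, hV, hΛ.2.comp hU, Λ₁, 1, 1, U, _, hΛ, hfac,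
    ⟨hU, isPartialIsometry_of_norm_eq hUn, fun n => ?_⟩, isCausalUnit_one, ?_, rfl,
    isCausalUnit_one, ?_, ?_⟩
  · rw [hUU]; rfl
  · ext1 x; exact hinv (U x)
  · have hnorm : ∀ x, ‖Λ₁.val x‖ ^ 2 = ‖W x‖ ^ 2 + ‖V x‖ ^ 2 := fun x => by
      have h1 := congrArg (fun T : Ell2 →L[ℂ] Ell2 => (inner ℂ (T x) x : ℂ)) hfac
      simp only [add_apply, ContinuousLinearMap.comp_apply, inner_add_left,
        ContinuousLinearMap.adjoint_inner_left, inner_self_eq_norm_sq_to_K] at h1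
      rw [← RCLike.ofReal_pow, ← RCLike.ofReal_pow, ← RCLike.ofReal_pow, ← RCLike.ofReal_add] at h1
      exact Complex.ofReal_injective h1
    have hiso : ∀ x, ‖(column W V ∘L Λi ∘L U) x‖ = ‖x‖ := fun x => by
      refine (sq_eq_sq₀ (norm_nonneg _) (norm_nonneg _)).mp ?_
      rw [ContinuousLinearMap.comp_apply, norm_column_sq, ← hnorm, ContinuousLinearMap.comp_apply,
        hinv, hUn]
    rw [(ContinuousLinearMap.norm_map_iff_adjoint_comp_self _).mp hiso, Units.val_one,
      ContinuousLinearMap.one_def, ContinuousLinearMap.adjoint_id]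
    rfl
  · rw [inv_one, Units.val_one]; rfl

/-- The isometry `e₀ ↦ e₀`, `e_n ↦ e_{n+1}` for `n ≥ 1`. -/
def gapShift : Ell2 →ₗᵢ[ℂ] Ell2 :=
  (orthonormal_unitVec.comp (fun n => if n = 0 then 0 else n + 1) (fun i j h => by
    simp only at h; split_ifs at h <;> omega)).orthogonalFamily.linearIsometry

theorem gapShift_hasSum (x : Ell2) (j : ℕ) :
    HasSum (fun n => x n * unitVec (if n = 0 then 0 else n + 1) j) (gapShift x j) := by
  have h := (orthonormal_unitVec.comp (fun n => if n = 0 then 0 else n + 1) (fun i j h => by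
    simp only at h; split_ifs at h <;> omega)).orthogonalFamily.hasSum_linearIsometry x
  have h1 := h.mapL (lp.evalCLM ℂ (fun _ : ℕ => ℂ) 2 j)
  exact h1

theorem gapShift_apply_zero (x : Ell2) : gapShift x 0 = x 0 := by
  refine (gapShift_hasSum x 0).unique ?_
  convert! hasSum_single (f := fun n => x n * unitVec (if n = 0 then 0 else n + 1) 0) 0 ?_ using 1
  · simp [unitVec_apply]
  · intro n hn
    simp [unitVec_apply, hn]

theorem gapShift_apply_one (x : Ell2) : gapShift x 1 = 0 := by
  refine (gapShift_hasSum x 1).unique ?_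
  convert! hasSum_zero using 2 with n
  rw [unitVec_apply]
  rcases n with _ | n <;> simp

theorem gapShift_apply_add_two (x : Ell2) (j : ℕ) : gapShift x (j + 2) = x (j + 1) := by
  refine (gapShift_hasSum x (j + 2)).unique ?_
  convert! hasSum_single (f := fun n => x n * unitVec (if n = 0 then 0 else n + 1) (j + 2)) (j + 1) ?_ using 1
  · simp [unitVec_apply]
  · intro n hn
    rw [unitVec_apply]
    rcases n with _ | n
    · simp
    · simp; omega

theorem isCausal_gapShift : IsCausal gapShift.toContinuousLinearMap :=
  isCausal_of_apply_eq_zero fun k x hx => by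
    rw [LinearIsometry.coe_toContinuousLinearMap]
    rcases k with _ | _ | k
    · rw [gapShift_apply_zero, hx 0 le_rfl]
    · exact gapShift_apply_one x
    · rw [gapShift_apply_add_two, hx (k + 1) (by omega)]

theorem hasSum_norm_sq (x : Ell2) : HasSum (fun j => ‖x j‖ ^ 2) (‖x‖ ^ 2) := by
  have h := lp.hasSum_norm (p := 2) (by norm_num) x
  simpa using h

theorem norm_apply_le_norm (x : Ell2) (j : ℕ) : ‖x j‖ ≤ ‖x‖ :=
  lp.norm_apply_le_norm (by norm_num) x j

theorem norm_unitVec (k : ℕ) : ‖unitVec k‖ = 1 := orthonormal_unitVec.1 k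

theorem norm_sq_eventuallyConstDiag_add_le {a b c a' b' c' : ℂ} {C : ℝ}
    (h0 : ‖a‖ ^ 2 + ‖a'‖ ^ 2 ≤ C) (h1 : ‖b‖ ^ 2 + ‖b'‖ ^ 2 ≤ C) (h2 : ‖c‖ ^ 2 + ‖c'‖ ^ 2 ≤ C)
    (x : Ell2) :
    ‖eventuallyConstDiag a b c x‖ ^ 2 + ‖eventuallyConstDiag a' b' c' x‖ ^ 2 ≤ C * ‖x‖ ^ 2 := by
  refine hasSum_le (fun j => ?_) ((hasSum_norm_sq _).add (hasSum_norm_sq _))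
    ((hasSum_norm_sq x).mul_left C)
  simp only [eventuallyConstDiag_apply, norm_mul, mul_pow]
  rw [← add_mul]
  refine mul_le_mul_of_nonneg_right ?_ (sq_nonneg _)
  split_ifs <;> assumption

theorem norm_smul_unitVec_add_sq {i j : ℕ} (hij : i ≠ j) (a b : ℂ) :
    ‖a • unitVec i + b • unitVec j‖ ^ 2 = ‖a‖ ^ 2 + ‖b‖ ^ 2 := by
  rw [@norm_add_sq ℂ, inner_smul_left, inner_smul_right, orthonormal_unitVec.2 hij, norm_smul,
    norm_smul, norm_unitVec, norm_unitVec]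
  simp

theorem sub_comp_column (A B C D Q : Ell2 →L[ℂ] Ell2) :
    column A B - column C D ∘L Q = column (A - C ∘L Q) (B - D ∘L Q) := rfl

/-! ### A noncompact example without allpass optimum -/

section NoAllpassOptimum

/-- A weight whose first two gains differ from the others. -/
def gapWeight : Ell2 →L[ℂ] Ell2 := eventuallyConstDiag (5 / 3) (1 / 2) 1

/-- The second weight, three quarters of `gapWeight`. -/
def gapWeight' : Ell2 →L[ℂ] Ell2 := eventuallyConstDiag (5 / 4) (3 / 8) (3 / 4)

/-- The outer spectral factor of the two weights. -/
def gapOuter : (Ell2 →L[ℂ] Ell2)ˣ :=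
  eventuallyConstDiagUnit (25 / 12) (5 / 8) (5 / 4) (by norm_num) (by norm_num) (by norm_num)

/-- The normalized factor of the two weights and the inner operator `gapShift`. -/
def gapFactor : Ell2 →L[ℂ] Ell2Sq :=
  column gapWeight gapWeight' ∘L ((gapOuter⁻¹ : (Ell2 →L[ℂ] Ell2)ˣ) : Ell2 →L[ℂ] Ell2) ∘L
    gapShift.toContinuousLinearMap

theorem isNormalizedFactor_gapFactor : IsNormalizedFactor gapWeight gapWeight'
    (((gapOuter⁻¹ : (Ell2 →L[ℂ] Ell2)ˣ) : Ell2 →L[ℂ] Ell2) ∘L gapShift.toContinuousLinearMap)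
    gapFactor := by
  refine isNormalizedFactor_of_isometry (isCausal_eventuallyConstDiag _ _ _)
    (isCausal_eventuallyConstDiag _ _ _) (isCausalUnit_eventuallyConstDiagUnit _ _ _ _ _ _) ?_
    isCausal_gapShift gapShift.norm_map
  change adjoint (eventuallyConstDiag _ _ _) ∘L eventuallyConstDiag _ _ _ = _
  simp only [adjoint_eventuallyConstDiag, eventuallyConstDiag_comp,
    eventuallyConstDiag_add]
  congr 1 <;> simp <;> norm_num

/-- The factor equals (4/5 U, 3/5 U) with U the gapped shift. Since 16/25 + 9/25 = 1 and U is
isometric, completing the square separates the part that Q influences. -/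
theorem norm_gap_error_sq (Q : Ell2 →L[ℂ] Ell2) (x : Ell2) :
    ‖(column gapWeight 0 - gapFactor ∘L Q) x‖ ^ 2 =
      ‖gapShift (Q x) - (4 / 5 : ℂ) • gapWeight x‖ ^ 2 + 9 / 25 * ‖gapWeight x‖ ^ 2 := by
  have hW : ∀ y, gapWeight (((gapOuter⁻¹ : (Ell2 →L[ℂ] Ell2)ˣ) : Ell2 →L[ℂ] Ell2) y) =
      (4 / 5 : ℂ) • y := fun y => by
    ext j
    change eventuallyConstDiag _ _ _ (eventuallyConstDiag _ _ _ y) j = _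
    rw [eventuallyConstDiag_apply, eventuallyConstDiag_apply, lp.coeFn_smul, Pi.smul_apply,
      smul_eq_mul]
    split_ifs <;> ring
  have hV : ∀ y, gapWeight' (((gapOuter⁻¹ : (Ell2 →L[ℂ] Ell2)ˣ) : Ell2 →L[ℂ] Ell2) y) =
      (3 / 5 : ℂ) • y := fun y => by
    ext j
    change eventuallyConstDiag _ _ _ (eventuallyConstDiag _ _ _ y) j = _
    rw [eventuallyConstDiag_apply, eventuallyConstDiag_apply, lp.coeFn_smul, Pi.smul_apply,
      smul_eq_mul]
    split_ifs <;> ring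
  have h1 : ‖(column gapWeight 0 - gapFactor ∘L Q) x‖ ^ 2 =
      ‖gapWeight x - (4 / 5 : ℂ) • gapShift (Q x)‖ ^ 2 + ‖0 - (3 / 5 : ℂ) • gapShift (Q x)‖ ^ 2 := by
    rw [← hW, ← hV]
    exact norm_column_sq (gapWeight - gapWeight ∘L
      (((gapOuter⁻¹ : (Ell2 →L[ℂ] Ell2)ˣ) : Ell2 →L[ℂ] Ell2) ∘L
        gapShift.toContinuousLinearMap ∘L Q)) (0 - gapWeight' ∘L
      (((gapOuter⁻¹ : (Ell2 →L[ℂ] Ell2)ˣ) : Ell2 →L[ℂ] Ell2) ∘L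
        gapShift.toContinuousLinearMap ∘L Q)) x
  rw [h1, zero_sub, norm_neg, @norm_sub_sq ℂ, @norm_sub_sq ℂ, inner_smul_right, inner_smul_right,
    norm_smul, norm_smul, norm_smul, ← inner_conj_symm]
  have h4 : (4 / 5 : ℂ) = ((4 / 5 : ℝ) : ℂ) := by push_cast; rfl
  have h3 : (3 / 5 : ℂ) = ((3 / 5 : ℝ) : ℂ) := by push_cast; rfl
  rw [h4, h3, Complex.norm_real, Complex.norm_real]
  simp only [RCLike.re_to_complex, Complex.re_ofReal_mul, Complex.conj_re]
  norm_num
  ring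

/-- On e₀ the term independent of Q is already 9/25 · (5/3)² = 1. -/
theorem one_le_norm_gap_error (Q : Ell2 →L[ℂ] Ell2) :
    1 ≤ ‖column gapWeight 0 - gapFactor ∘L Q‖ := by
  have h1 := (column gapWeight 0 - gapFactor ∘L Q).le_opNorm (unitVec 0)
  rw [norm_unitVec, mul_one] at h1
  refine le_trans ((one_le_sq_iff₀ (norm_nonneg _)).mp ?_) h1
  rw [norm_gap_error_sq]
  have h2 : ‖gapWeight (unitVec 0)‖ = 5 / 3 := by
    rw [gapWeight, eventuallyConstDiag_unitVec, if_pos rfl, norm_smul, norm_unitVec]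
    norm_num
  rw [h2]
  nlinarith [sq_nonneg ‖gapShift (Q (unitVec 0)) - (4 / 5 : ℂ) • gapWeight (unitVec 0)‖]

/-- The gain 4/3 = 4/5 · 5/3 cancels the first entry. The squared gains are then 1 on e₀, (2/5)² +
(3/10)² = 1/4 on e₁ and (4/5)² + (3/5)² = 1 on the tail. -/
theorem norm_gap_error_le :
    ‖column gapWeight 0 - gapFactor ∘L eventuallyConstDiag (4 / 3) 0 0‖ ≤ 1 := by
  refine ContinuousLinearMap.opNorm_le_bound _ zero_le_one fun x => ?_
  rw [one_mul]
  refine (sq_le_sq₀ (norm_nonneg _) (norm_nonneg _)).mp ?_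
  rw [norm_gap_error_sq]
  have h1 : gapShift (eventuallyConstDiag (4 / 3) 0 0 x) - (4 / 5 : ℂ) • gapWeight x =
      eventuallyConstDiag 0 (-(2 / 5)) (-(4 / 5)) x := by
    ext j
    rw [lp.coeFn_sub, Pi.sub_apply, lp.coeFn_smul, Pi.smul_apply, gapWeight,
      eventuallyConstDiag_apply, eventuallyConstDiag_apply, smul_eq_mul]
    rcases j with _ | _ | j
    · rw [gapShift_apply_zero, eventuallyConstDiag_apply]
      simp
      ring
    · rw [gapShift_apply_one]
      simp
      ring
    · rw [gapShift_apply_add_two, eventuallyConstDiag_apply]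
      simp
  have h2 : 9 / 25 * ‖gapWeight x‖ ^ 2 =
      ‖eventuallyConstDiag 1 (3 / 10) (3 / 5) x‖ ^ 2 := by
    have h3 : eventuallyConstDiag 1 (3 / 10) (3 / 5) x = (3 / 5 : ℂ) • gapWeight x := by
      ext j
      rw [lp.coeFn_smul, Pi.smul_apply, gapWeight, eventuallyConstDiag_apply,
        eventuallyConstDiag_apply, smul_eq_mul]
      split_ifs <;> ring
    rw [h3, norm_smul]
    norm_num
    ring
  rw [h1, h2]
  refine (norm_sq_eventuallyConstDiag_add_le (C := 1) ?_ ?_ ?_ x).trans (one_mul _).le <;> norm_num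

theorem muCausal_gap : muCausal (column gapWeight 0) gapFactor = 1 :=
  le_antisymm ((muCausal_le _ _ (isCausal_eventuallyConstDiag _ _ _)).trans norm_gap_error_le)
    (le_muCausal fun Q _ => one_le_norm_gap_error Q)

/-- A causal operator which is optimal annihilates the second unit vector. -/
theorem apply_unitVec_one_eq_zero_of_norm_gap_error_le {Q : Ell2 →L[ℂ] Ell2} (hQ : IsCausal Q)
    (h : ‖column gapWeight 0 - gapFactor ∘L Q‖ ≤ 1) : Q (unitVec 1) = 0 := by
  ext j
  rcases j with _ | j
  · exact hQ.apply_eq_zero fun i hi => by rw [unitVec_apply, if_neg (by omega)]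
  · change Q (unitVec 1) (j + 1) = 0
    by_contra hq
    set q := Q (unitVec 1) (j + 1) with hqdef
    have hq0 : 0 < ‖q‖ := norm_pos_iff.mpr hq
    -- Causality and the shift keep Qe_{j+2} out of row j + 2, so e_{j+2} is saturated. This t
    -- aligns q with -4/5 t: the cross term is 8/5, the ‖t‖² terms cancel, and ‖q‖² + 8/5 + 9/100 ≤
    -- 1 is absurd.
    set t : ℂ := -(star q)⁻¹ with ht
    have h1 := (column gapWeight 0 - gapFactor ∘L Q).le_of_opNorm_le h
      ((1 : ℂ) • unitVec 1 + t • unitVec (j + 2))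
    rw [one_mul] at h1
    have h2 := pow_le_pow_left₀ (norm_nonneg _) h1 2
    have hWx : gapWeight ((1 : ℂ) • unitVec 1 + t • unitVec (j + 2)) =
        (1 / 2 : ℂ) • unitVec 1 + t • unitVec (j + 2) := by
      rw [map_add, map_smul, map_smul, gapWeight, eventuallyConstDiag_unitVec,
        eventuallyConstDiag_unitVec]
      simp
    rw [norm_gap_error_sq, hWx, norm_smul_unitVec_add_sq (by omega),
      norm_smul_unitVec_add_sq (by omega)] at h2
    have h3 := norm_apply_le_norm
      (gapShift (Q ((1 : ℂ) • unitVec 1 + t • unitVec (j + 2))) -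
        (4 / 5 : ℂ) • ((1 / 2 : ℂ) • unitVec 1 + t • unitVec (j + 2))) (j + 2)
    have h4 : Q (unitVec (j + 2)) (j + 1) = 0 :=
      hQ.apply_eq_zero fun i hi => by rw [unitVec_apply, if_neg (by omega)]
    have h5 : (gapShift (Q ((1 : ℂ) • unitVec 1 + t • unitVec (j + 2))) -
        (4 / 5 : ℂ) • ((1 / 2 : ℂ) • unitVec 1 + t • unitVec (j + 2))) (j + 2) =
        q - 4 / 5 * t := by
      rw [lp.coeFn_sub, Pi.sub_apply, gapShift_apply_add_two, map_add, map_smul, map_smul]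
      simp only [lp.coeFn_add, lp.coeFn_smul, Pi.add_apply, Pi.smul_apply, h4, unitVec_apply,
        ← hqdef, smul_eq_mul]
      simp
    have h6 : q - 4 / 5 * t = q * ((1 + 4 / 5 * (‖q‖ ^ 2)⁻¹ : ℝ) : ℂ) := by
      have hqq : (‖q‖ : ℂ) ^ 2 = q * star q := by
        rw [RCLike.star_def, Complex.mul_conj']
      have hsq : star q ≠ 0 := star_ne_zero.mpr hq
      push_cast
      rw [hqq, ht]
      field_simp
      ring
    have ht2 : ‖t‖ ^ 2 = (‖q‖ ^ 2)⁻¹ := by rw [ht, norm_neg, norm_inv, norm_star, inv_pow]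
    rw [h5, h6, norm_mul, Complex.norm_real, Real.norm_eq_abs, abs_of_pos (by positivity)] at h3
    have h7 := pow_le_pow_left₀ (by positivity) h3 2
    have h8 : (‖q‖ * (1 + 4 / 5 * (‖q‖ ^ 2)⁻¹)) ^ 2 =
        ‖q‖ ^ 2 + 8 / 5 + 16 / 25 * (‖q‖ ^ 2)⁻¹ := by
      field_simp
      ring
    rw [h8] at h7
    have hhalf : ‖(1 / 2 : ℂ)‖ ^ 2 = 1 / 4 := by norm_num
    rw [ht2, hhalf, norm_one] at h2
    linarith [sq_nonneg ‖q‖]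

/-- The weight is injective, so the error has trivial kernel and would have to be isometric; but Qe₁
= 0 leaves squared gain 1/4 on e₁. -/
theorem not_isPartialIsometry_gap {Q : Ell2 →L[ℂ] Ell2}
    (hQ : IsOptimal (column gapWeight 0) gapFactor Q) :
    ¬ IsPartialIsometry (normalizedError (column gapWeight 0) gapFactor Q) := fun hpi => by
  have herr : normalizedError (column gapWeight 0) gapFactor Q =
      column gapWeight 0 - gapFactor ∘L Q := by
    rw [normalizedError, muCausal_gap]
    simp
  rw [herr] at hpi
  have hQ1 := apply_unitVec_one_eq_zero_of_norm_gap_error_le hQ.1 (hQ.2.trans muCausal_gap).le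
  have h1 := hpi (unitVec 1) fun u hu => by
    have h2 := norm_gap_error_sq Q u
    have h3 : (column gapWeight 0 - gapFactor ∘L Q) u = 0 := hu
    rw [h3, norm_zero] at h2
    have h4 : gapWeight u = 0 := by
      rw [← norm_eq_zero, ← sq_eq_zero_iff]
      nlinarith [sq_nonneg ‖gapShift (Q u) - (4 / 5 : ℂ) • gapWeight u‖, sq_nonneg ‖gapWeight u‖]
    have h5 : u = 0 := by
      ext j
      have h6 : gapWeight u j = 0 := by rw [h4]; rfl
      rw [gapWeight, eventuallyConstDiag_apply] at h6
      refine (mul_eq_zero.mp h6).resolve_left ?_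
      split_ifs <;> norm_num
    rw [h5, inner_zero_left]
  have h2 := norm_gap_error_sq Q (unitVec 1)
  rw [h1, hQ1, map_zero, gapWeight, eventuallyConstDiag_unitVec, norm_unitVec, zero_sub, norm_neg,
    norm_smul, norm_smul, norm_unitVec] at h2
  norm_num at h2

end NoAllpassOptimum

/-! ### A compact example with an optimum that is not allpass -/

section CompactNonAllpassOptimum

/-- A weight of rank one. -/
def rankOneWeight : Ell2 →L[ℂ] Ell2 := eventuallyConstDiag (4 / 5) 0 0

/-- The weight complementary to `rankOneWeight`: the squares add up to the identity. -/
def rankOneWeight' : Ell2 →L[ℂ] Ell2 := eventuallyConstDiag (3 / 5) 1 1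

/-- An optimum for the rank one weight, with a superfluous second gain. -/
def rankOneOptimum : Ell2 →L[ℂ] Ell2 := eventuallyConstDiag (16 / 25) (6 / 25) 0

theorem isNormalizedFactor_rankOne : IsNormalizedFactor rankOneWeight rankOneWeight'
    (ContinuousLinearMap.id ℂ Ell2) (column rankOneWeight rankOneWeight') := by
  refine isNormalizedFactor_of_isometry (Λ₁ := 1) (isCausal_eventuallyConstDiag _ _ _)
    (isCausal_eventuallyConstDiag _ _ _) isCausalUnit_one ?_ isCausal_id fun x => rfl
  rw [adjoint_eventuallyConstDiag, adjoint_eventuallyConstDiag,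
    eventuallyConstDiag_comp, eventuallyConstDiag_comp, eventuallyConstDiag_add, Units.val_one,
    ContinuousLinearMap.one_def, ContinuousLinearMap.adjoint_id, ContinuousLinearMap.id_comp,
    ← eventuallyConstDiag_one]
  congr 1 <;> simp <;> norm_num

/-- With y the corner entry of Q, the corner contributes 16/25 |1 - y|² + 9/25 |y|², whose minimum
(12/25)² is at y = 16/25. -/
theorem le_norm_rankOne_error (Q : Ell2 →L[ℂ] Ell2) :
    12 / 25 ≤ ‖column rankOneWeight 0 - column rankOneWeight rankOneWeight' ∘L Q‖ := by
  have h1 := (column rankOneWeight 0 - column rankOneWeight rankOneWeight' ∘L Q).le_opNorm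
    (unitVec 0)
  rw [norm_unitVec, mul_one] at h1
  refine le_trans ((sq_le_sq₀ (by norm_num) (norm_nonneg _)).mp ?_) h1
  rw [sub_comp_column, norm_column_sq]
  have h2 := norm_apply_le_norm ((rankOneWeight - rankOneWeight ∘L Q) (unitVec 0)) 0
  have h3 := norm_apply_le_norm ((0 - rankOneWeight' ∘L Q) (unitVec 0)) 0
  have h4 := pow_le_pow_left₀ (norm_nonneg _) h2 2
  have h5 := pow_le_pow_left₀ (norm_nonneg _) h3 2
  refine le_trans ?_ (add_le_add h4 h5)
  set y : ℂ := Q (unitVec 0) 0 with hy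
  have h6 : (rankOneWeight - rankOneWeight ∘L Q) (unitVec 0) 0 = 4 / 5 - 4 / 5 * y := by
    rw [sub_apply, lp.coeFn_sub, Pi.sub_apply, ContinuousLinearMap.comp_apply, rankOneWeight,
      eventuallyConstDiag_apply, eventuallyConstDiag_apply, unitVec_apply, ← hy]
    simp
  have h7 : (0 - rankOneWeight' ∘L Q) (unitVec 0) 0 = -(3 / 5 * y) := by
    rw [zero_sub, neg_apply, lp.coeFn_neg, Pi.neg_apply, ContinuousLinearMap.comp_apply,
      rankOneWeight', eventuallyConstDiag_apply, ← hy]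
    simp
  rw [h6, h7, ← Complex.normSq_eq_norm_sq, ← Complex.normSq_eq_norm_sq, Complex.normSq_apply,
    Complex.normSq_apply]
  simp
  nlinarith [sq_nonneg (y.re - 16 / 25), sq_nonneg y.im]

theorem norm_rankOne_error_sq (x : Ell2) :
    ‖(column rankOneWeight 0 - column rankOneWeight rankOneWeight' ∘L rankOneOptimum) x‖ ^ 2 =
      ‖eventuallyConstDiag (36 / 125) 0 0 x‖ ^ 2 +
        ‖eventuallyConstDiag (-(48 / 125)) (-(6 / 25)) 0 x‖ ^ 2 := by
  rw [sub_comp_column, norm_column_sq]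
  congr 4
  · ext x j
    rw [sub_apply, lp.coeFn_sub, Pi.sub_apply, ContinuousLinearMap.comp_apply, rankOneWeight,
      rankOneOptimum]
    simp only [eventuallyConstDiag_apply]
    split_ifs <;> ring
  · ext x j
    rw [zero_sub, neg_apply, lp.coeFn_neg, Pi.neg_apply, ContinuousLinearMap.comp_apply,
      rankOneWeight', rankOneOptimum]
    simp only [eventuallyConstDiag_apply]
    split_ifs <;> ring

theorem norm_rankOne_error_le :
    ‖column rankOneWeight 0 - column rankOneWeight rankOneWeight' ∘L rankOneOptimum‖ ≤ 12 / 25 := by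
  refine ContinuousLinearMap.opNorm_le_bound _ (by norm_num) fun x => ?_
  refine (sq_le_sq₀ (norm_nonneg _) (by positivity)).mp ?_
  rw [norm_rankOne_error_sq, mul_pow]
  refine norm_sq_eventuallyConstDiag_add_le ?_ ?_ ?_ x <;> norm_num

theorem muCausal_rankOne :
    muCausal (column rankOneWeight 0) (column rankOneWeight rankOneWeight') = 12 / 25 :=
  le_antisymm ((muCausal_le _ _ (isCausal_eventuallyConstDiag _ _ _)).trans norm_rankOne_error_le)
    (le_muCausal fun Q _ => le_norm_rankOne_error Q)

theorem isOptimal_rankOneOptimum :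
    IsOptimal (column rankOneWeight 0) (column rankOneWeight rankOneWeight') rankOneOptimum :=
  ⟨isCausal_eventuallyConstDiag _ _ _,
    (le_antisymm norm_rankOne_error_le (le_norm_rankOne_error _)).trans muCausal_rankOne.symm⟩

/-- The vector e₁ is orthogonal to the kernel, yet its gain 6/25 is only half of μ_o = 12/25. -/
theorem not_isPartialIsometry_rankOne : ¬ IsPartialIsometry (normalizedError
    (column rankOneWeight 0) (column rankOneWeight rankOneWeight') rankOneOptimum) := fun hpi => by
  have h1 := hpi (unitVec 1) fun u hu => by
    have h2 : normalizedError (column rankOneWeight 0) (column rankOneWeight rankOneWeight')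
      rankOneOptimum u = 0 := hu
    rw [normalizedError, smul_apply, muCausal_rankOne, smul_eq_zero] at h2
    have h3 := h2.resolve_left (by norm_num)
    have h4 := norm_rankOne_error_sq u
    rw [h3, norm_zero] at h4
    have h5 : eventuallyConstDiag (-(48 / 125)) (-(6 / 25)) 0 u = 0 := by
      rw [← norm_eq_zero, ← sq_eq_zero_iff]
      nlinarith [sq_nonneg ‖eventuallyConstDiag (36 / 125) 0 0 u‖,
        sq_nonneg ‖eventuallyConstDiag (-(48 / 125)) (-(6 / 25)) 0 u‖]
    have h6 : eventuallyConstDiag (-(48 / 125)) (-(6 / 25)) 0 u 1 = 0 := by rw [h5]; rfl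
    rw [eventuallyConstDiag_apply] at h6
    rw [← inner_conj_symm, inner_unitVec_left]
    have h7 : u 1 = 0 := (mul_eq_zero.mp h6).resolve_left (by norm_num)
    rw [h7, map_zero]
  have h2 := norm_rankOne_error_sq (unitVec 1)
  rw [normalizedError, smul_apply, norm_smul, muCausal_rankOne, norm_unitVec] at h1
  rw [eventuallyConstDiag_unitVec, eventuallyConstDiag_unitVec, norm_smul, norm_smul,
    norm_unitVec] at h2
  norm_num at h1 h2
  nlinarith

theorem isCompactOperator_column_rankOne : IsCompactOperator (column rankOneWeight 0) :=
  (isCompactOperator_eventuallyConstDiag (4 / 5) 0).clm_comp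
    (column (ContinuousLinearMap.id ℂ Ell2) 0)

end CompactNonAllpassOptimum

end MixedSensitivity

end

theorem lemma4 :
    -- the allpass property of the optimum
    (∀ (W V P : MixedSensitivity.Ell2 →L[ℂ] MixedSensitivity.Ell2)
        (T₁ R₂ : MixedSensitivity.Ell2 →L[ℂ] MixedSensitivity.Ell2Sq),
      MixedSensitivity.IsNormalizedFactor W V P R₂ →
      T₁ = MixedSensitivity.column W 0 →
      IsCompactOperator T₁ →
      MixedSensitivity.muCompact T₁ R₂ < MixedSensitivity.muCausal T₁ R₂ →
      ∃ Q₀ : MixedSensitivity.Ell2 →L[ℂ] MixedSensitivity.Ell2,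
        MixedSensitivity.IsOptimal T₁ R₂ Q₀ ∧
        MixedSensitivity.IsPartialIsometry (MixedSensitivity.normalizedError T₁ R₂ Q₀)) ∧
    -- sharpness: without the condition it can happen that no optimum is allpass
    (∃ (W V P : MixedSensitivity.Ell2 →L[ℂ] MixedSensitivity.Ell2)
        (T₁ R₂ : MixedSensitivity.Ell2 →L[ℂ] MixedSensitivity.Ell2Sq),
      MixedSensitivity.IsNormalizedFactor W V P R₂ ∧
      T₁ = MixedSensitivity.column W 0 ∧
      ¬ (MixedSensitivity.muCompact T₁ R₂ < MixedSensitivity.muCausal T₁ R₂) ∧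
      (∀ Q : MixedSensitivity.Ell2 →L[ℂ] MixedSensitivity.Ell2,
        MixedSensitivity.muCausal T₁ R₂ ≤ ‖T₁ - R₂ ∘L Q‖) ∧
      0 < MixedSensitivity.muCausal T₁ R₂ ∧
      (∃ Q₀ : MixedSensitivity.Ell2 →L[ℂ] MixedSensitivity.Ell2,
        MixedSensitivity.IsOptimal T₁ R₂ Q₀) ∧
      ∀ Q₀ : MixedSensitivity.Ell2 →L[ℂ] MixedSensitivity.Ell2,
        MixedSensitivity.IsOptimal T₁ R₂ Q₀ →
        ¬ MixedSensitivity.IsPartialIsometry (MixedSensitivity.normalizedError T₁ R₂ Q₀)) ∧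
    -- sharpness with `T₁` compact: an optimum need not be allpass
    (∃ (W V P : MixedSensitivity.Ell2 →L[ℂ] MixedSensitivity.Ell2)
        (T₁ R₂ : MixedSensitivity.Ell2 →L[ℂ] MixedSensitivity.Ell2Sq),
      MixedSensitivity.IsNormalizedFactor W V P R₂ ∧
      T₁ = MixedSensitivity.column W 0 ∧
      IsCompactOperator T₁ ∧
      ¬ (MixedSensitivity.muCompact T₁ R₂ < MixedSensitivity.muCausal T₁ R₂) ∧
      0 < MixedSensitivity.muCausal T₁ R₂ ∧
      ∃ Q₀ : MixedSensitivity.Ell2 →L[ℂ] MixedSensitivity.Ell2,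
        MixedSensitivity.IsOptimal T₁ R₂ Q₀ ∧
        ¬ MixedSensitivity.IsPartialIsometry (MixedSensitivity.normalizedError T₁ R₂ Q₀)) := by
  refine ⟨fun W V P T₁ R₂ hR _ hT hμ =>
    MixedSensitivity.exists_isOptimal_isPartialIsometry hR.adjoint_comp_self hT hμ, ?_, ?_⟩
  · refine ⟨_, _, _, _, _, MixedSensitivity.isNormalizedFactor_gapFactor, rfl, ?_, fun Q => ?_, ?_,
      ⟨MixedSensitivity.eventuallyConstDiag (4 / 3) 0 0,
        MixedSensitivity.isCausal_eventuallyConstDiag _ _ _, ?_⟩,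
      fun Q hQ => MixedSensitivity.not_isPartialIsometry_gap hQ⟩
    · rw [not_lt, MixedSensitivity.muCausal_gap]
      exact MixedSensitivity.le_muCompact MixedSensitivity.one_le_norm_gap_error
    · rw [MixedSensitivity.muCausal_gap]
      exact MixedSensitivity.one_le_norm_gap_error Q
    · rw [MixedSensitivity.muCausal_gap]
      exact one_pos
    · rw [MixedSensitivity.muCausal_gap]
      exact le_antisymm MixedSensitivity.norm_gap_error_le
        (MixedSensitivity.one_le_norm_gap_error _)
  · refine ⟨_, _, _, _, _, MixedSensitivity.isNormalizedFactor_rankOne, rfl,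
      MixedSensitivity.isCompactOperator_column_rankOne, ?_, ?_, _,
      MixedSensitivity.isOptimal_rankOneOptimum, MixedSensitivity.not_isPartialIsometry_rankOne⟩
    · rw [not_lt, MixedSensitivity.muCausal_rankOne]
      exact MixedSensitivity.le_muCompact MixedSensitivity.le_norm_rankOne_error
    · rw [MixedSensitivity.muCausal_rankOne]
      norm_num
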